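/- For a C*-algebra $A$, let $\mathrm{Ped}(A)$ be its Pedersen ideal: the linear span of the positive elements of $A$ dominated by a finite sum of positive elements $a$ for which some positive $e\in A$ satisfies $ea=a$. Give $\mathrm{Ped}(A)$ the locally convex inductive limit topology, i.e. the finest locally convex vector space topology for which the inclusions of all C*-subalgebras $D\subseteq A$ with $D\subseteq\mathrm{Ped}(A)$ (with their norm topologies) are continuous. Let $T_{\mathbb R}(A)$ be the real vector space of continuous self-adjoint tracial linear functionals $\tau\colon \mathrm{Ped}(A)\to\mathbb C$, with the weak*-topology (pointwise convergence on $\mathrm{Ped}(A)$), ordered by the cone $T_+(A)$ of positive traces. Let $T_{\mathbb R}(A)^*$ be the space of continuous linear functionals $T_{\mathbb R}(A)\to\mathbb R$, with the compact-open topology, ordered by the cone of functionals that are nonnegative on $T_+(A)$. An isomorphism of ordered topological vector spaces is a linear homeomorphism that maps the positive cone onto the positive cone. (1) Let $A\subseteq B$ be a full hereditary C*-subalgebra of a C*-algebra $B$. Then the restriction map $T_{\mathbb R}(B)\to T_{\mathbb R}(A)$, $\tau\mapsto\tau|_{\mathrm{Ped}(A)}$, is an isomorphism of ordered topological vector spaces,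 and so is the induced map $T_{\mathbb R}(A)^*\to T_{\mathbb R}(B)^*$, $f\mapsto f(\,\cdot\,|_{\mathrm{Ped}(A)})$. (2) (Stability.) For every C*-algebra $A$, the corner inclusion $A\to A\otimes\mathcal K(\ell^2(\mathbb N))$, $a\mapsto a\otimes e_{00}$, where $e_{00}$ is the matrix unit of the first basis vector, induces isomorphisms of ordered topological vector spaces $T_{\mathbb R}(A\otimes\mathcal K(\ell^2(\mathbb N)))\to T_{\mathbb R}(A)$ and $T_{\mathbb R}(A)^*\to T_{\mathbb R}(A\otimes\mathcal K(\ell^2(\mathbb N)))^*$. (3) (Morita invariance.) If $A$ and $B$ are Morita equivalent C*-algebras, i.e. isomorphic to full hereditary C*-subalgebras of a common C*-algebra, then there is an isomorphism of ordered topological vector spaces $T_{\mathbb R}(B)\to T_{\mathbb R}(A)$ whose induced map $T_{\mathbb R}(A)^*\to T_{\mathbb R}(B)^*$ is also such an isomorphism. -/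

import Mathlib

open scoped ComplexOrder CompactConvergenceCLM Topology

universe u v w

/-! ## Positive elements and the Pedersen ideal -/

/-- Positivity in a C*-algebra: `a` has the form `b* b`. -/
def IsPos {A : Type*} [NonUnitalCStarAlgebra A] (a : A) : Prop :=
  ∃ b : A, a = star b * b

/-- `IsPos` is positivity for Mathlib's C*-algebraic order. -/
theorem isPos_iff_nonneg {A : Type*} [NonUnitalCStarAlgebra A] [PartialOrder A]
    [StarOrderedRing A] (a : A) : IsPos a ↔ 0 ≤ a :=
  CStarAlgebra.nonneg_iff_eq_star_mul_self.symm

theorem IsPos.zero {A : Type*} [NonUnitalCStarAlgebra A] : IsPos (0 : A) := ⟨0, by simp⟩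

theorem IsPos.add {A : Type*} [NonUnitalCStarAlgebra A] {a b : A} (ha : IsPos a) (hb : IsPos b) :
    IsPos (a + b) := by
  let _ := CStarAlgebra.spectralOrder A
  have := CStarAlgebra.spectralOrderedRing A
  rw [isPos_iff_nonneg] at *
  exact add_nonneg ha hb

theorem IsPos.star_eq {A : Type*} [NonUnitalCStarAlgebra A] {a : A} (ha : IsPos a) :
    star a = a := by
  obtain ⟨b, rfl⟩ := ha
  simp

theorem IsPos.map {A B : Type*} [NonUnitalCStarAlgebra A] [NonUnitalCStarAlgebra B]
    (φ : A →⋆ₙₐ[ℂ] B) {a : A} (ha : IsPos a) : IsPos (φ a) := by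
  obtain ⟨b, rfl⟩ := ha
  exact ⟨φ b, by rw [map_mul, map_star]⟩

/-- The positive elements `a` for which there is a positive `e` with `e a = a`. -/
def pedGen (A : Type*) [NonUnitalCStarAlgebra A] : Set A :=
  {a | IsPos a ∧ ∃ e : A, IsPos e ∧ e * a = a}

/-- The hereditary cone generated by `pedGen A`: the positive elements dominated by a finite sum
of elements of `pedGen A`. -/
def pedPos (A : Type*) [NonUnitalCStarAlgebra A] : Set A :=
  {a | IsPos a ∧ ∃ s ∈ AddSubmonoid.closure (pedGen A), IsPos (s - a)}

namespace PedersenIdeal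

variable {A : Type*} [NonUnitalCStarAlgebra A]

/-- The element `x z` of `A`, for `x` in `A` and `z` in the unitization. -/
def rmul (x : A) (z : Unitization ℂ A) : A := z.fst • x + x * z.snd

theorem inr_rmul (x : A) (z : Unitization ℂ A) :
    (Unitization.inr (rmul x z) : Unitization ℂ A) = Unitization.inr x * z := by
  ext <;> simp [rmul]

/-- The element `z* x z` of `A`. -/
def conjBy (x : A) (z : Unitization ℂ A) : A := star (rmul (star (rmul x z)) z)

theorem inr_conjBy (x : A) (z : Unitization ℂ A) :
    (Unitization.inr (conjBy x z) : Unitization ℂ A) = star z * Unitization.inr x * z := by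
  rw [conjBy, Unitization.inr_star, inr_rmul, Unitization.inr_star, inr_rmul]
  simp [mul_assoc]

theorem conjBy_add (x y : A) (z : Unitization ℂ A) :
    conjBy (x + y) z = conjBy x z + conjBy y z := by
  apply Unitization.inr_injective (R := ℂ)
  simp [inr_conjBy, mul_add, add_mul]

theorem conjBy_pos {x : A} (hx : IsPos x) (z : Unitization ℂ A) :
    IsPos (conjBy x z) := by
  obtain ⟨b, rfl⟩ := hx
  refine ⟨rmul b z, Unitization.inr_injective (R := ℂ) ?_⟩
  simp [inr_conjBy, inr_rmul, mul_assoc]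

theorem conjBy_pedGen {x : A} (hx : x ∈ pedGen A) {u : Unitization ℂ A}
    (hu : u ∈ unitary (Unitization ℂ A)) : conjBy x u ∈ pedGen A := by
  obtain ⟨hp, e, he, hex⟩ := hx
  refine ⟨conjBy_pos hp u, conjBy e u, conjBy_pos he u, Unitization.inr_injective (R := ℂ) ?_⟩
  have hu2 : u * star u = 1 := (Unitary.mem_iff.1 hu).2
  calc (Unitization.inr (conjBy e u * conjBy x u) : Unitization ℂ A)
      = star u * Unitization.inr e * (u * star u) * Unitization.inr x * u := by
        simp only [Unitization.inr_mul, inr_conjBy, mul_assoc]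
    _ = star u * Unitization.inr (e * x) * u := by
        rw [hu2, mul_one, Unitization.inr_mul]; simp only [mul_assoc]
    _ = _ := by rw [hex, inr_conjBy]

theorem conjBy_closure {s : A} (hs : s ∈ AddSubmonoid.closure (pedGen A))
    {u : Unitization ℂ A} (hu : u ∈ unitary (Unitization ℂ A)) :
    conjBy s u ∈ AddSubmonoid.closure (pedGen A) := by
  induction hs using AddSubmonoid.closure_induction with
  | mem x hx => exact AddSubmonoid.subset_closure (conjBy_pedGen hx hu)
  | zero =>
    have : conjBy (0 : A) u = 0 := Unitization.inr_injective (R := ℂ) (by simp [inr_conjBy])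
    rw [this]; exact zero_mem _
  | add x y _ _ hx hy => rw [conjBy_add]; exact add_mem hx hy

theorem conjBy_one_add_mem {x : A} (hx : x ∈ pedPos A) {u : Unitization ℂ A}
    (hu : u ∈ unitary (Unitization ℂ A)) : conjBy x (1 + u) ∈ pedPos A := by
  obtain ⟨hp, s, hs, hsx⟩ := hx
  refine ⟨conjBy_pos hp _, (s + s) + (conjBy s u + conjBy s u),
    add_mem (add_mem hs hs) (add_mem (conjBy_closure hs hu) (conjBy_closure hs hu)), ?_⟩
  have key : (s + s) + (conjBy s u + conjBy s u) - conjBy x (1 + u)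
      = ((s - x) + (s - x)) + (conjBy (s - x) u + conjBy (s - x) u) + conjBy x (1 - u) := by
    apply Unitization.inr_injective (R := ℂ)
    simp only [Unitization.inr_add, Unitization.inr_sub, inr_conjBy, star_add, star_sub, star_one]
    noncomm_ring
  rw [key]
  exact ((hsx.add hsx).add ((conjBy_pos hsx u).add (conjBy_pos hsx u))).add (conjBy_pos hp _)

theorem rmul_unitary_mem {x : A} (hx : x ∈ pedPos A) {u : Unitization ℂ A}
    (hu : u ∈ unitary (Unitization ℂ A)) : rmul x u ∈ Submodule.span ℂ (pedPos A) := by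
  have hI : ∀ c : ℂ, star c * c = 1 → c • u ∈ unitary (Unitization ℂ A) := by
    intro c hc
    have h1 := Unitary.mem_iff.1 hu
    refine Unitary.mem_iff.2 ⟨?_, ?_⟩
    · rw [star_smul, smul_mul_smul_comm, hc, one_smul, h1.1]
    · rw [star_smul, smul_mul_smul_comm, mul_comm, hc, one_smul, h1.2]
  have h1 := conjBy_one_add_mem hx (hI 1 (by simp))
  have h2 := conjBy_one_add_mem hx (hI (-1) (by simp))
  have h3 := conjBy_one_add_mem hx (hI Complex.I (by simp))
  have h4 := conjBy_one_add_mem hx (hI (-Complex.I) (by simp))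
  have key : rmul x u = (1 / 4 : ℂ) • conjBy x (1 + (1 : ℂ) • u)
      + (-1 / 4 : ℂ) • conjBy x (1 + (-1 : ℂ) • u)
      + (-Complex.I / 4 : ℂ) • conjBy x (1 + Complex.I • u)
      + (Complex.I / 4 : ℂ) • conjBy x (1 + (-Complex.I) • u) := by
    apply Unitization.inr_injective (R := ℂ)
    simp only [Unitization.inr_add, Unitization.inr_smul, inr_conjBy, inr_rmul, star_add,
      star_one, star_smul, add_mul, mul_add, one_mul, mul_one, smul_mul_assoc, mul_smul_comm]
    match_scalars <;> simp <;> ring_nf <;> norm_num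
  rw [key]
  exact add_mem (add_mem (add_mem (Submodule.smul_mem _ _ (Submodule.subset_span h1))
    (Submodule.smul_mem _ _ (Submodule.subset_span h2)))
    (Submodule.smul_mem _ _ (Submodule.subset_span h3)))
    (Submodule.smul_mem _ _ (Submodule.subset_span h4))

/-- The span of the hereditary cone is a right ideal. -/
theorem span_mul_mem {x : A} (hx : x ∈ Submodule.span ℂ (pedPos A)) (a : A) :
    x * a ∈ Submodule.span ℂ (pedPos A) := by
  induction hx using Submodule.span_induction with
  | mem x hx =>
    have h : ∀ z : Unitization ℂ A, rmul x z ∈ Submodule.span ℂ (pedPos A) := by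
      intro z
      have hz : z ∈ Submodule.span ℂ (unitary (Unitization ℂ A) : Set (Unitization ℂ A)) := by
        rw [CStarAlgebra.span_unitary]; trivial
      induction hz using Submodule.span_induction with
      | mem u hu => exact rmul_unitary_mem hx hu
      | zero =>
        have : rmul x (0 : Unitization ℂ A) = 0 := by simp [rmul]
        rw [this]; exact zero_mem _
      | add y z _ _ hy hz =>
        have : rmul x (y + z) = rmul x y + rmul x z := Unitization.inr_injective (R := ℂ) (by simp [inr_rmul, mul_add])
        rw [this]; exact add_mem hy hz
      | smul c z _ hz =>
        have : rmul x (c • z) = c • rmul x z := Unitization.inr_injective (R := ℂ) (by simp [inr_rmul])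
        rw [this]; exact Submodule.smul_mem _ _ hz
    have h2 := h (Unitization.inr a)
    simpa [rmul] using h2
  | zero => simp
  | add x y _ _ hx hy => rw [add_mul]; exact add_mem hx hy
  | smul c x _ hx => rw [smul_mul_assoc]; exact Submodule.smul_mem _ _ hx

end PedersenIdeal

/-- The Pedersen ideal of `A`: the linear span of the hereditary cone `pedPos A`. -/
def Ped (A : Type*) [NonUnitalCStarAlgebra A] : NonUnitalStarSubalgebra ℂ A where
  __ := Submodule.span ℂ (pedPos A)
  mul_mem' := fun {_ y} hx _ => PedersenIdeal.span_mul_mem hx y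
  star_mem' := by
    intro a ha
    change a ∈ Submodule.span ℂ (pedPos A) at ha
    change star a ∈ Submodule.span ℂ (pedPos A)
    induction ha using Submodule.span_induction with
    | mem x hx => rw [hx.1.star_eq]; exact Submodule.subset_span hx
    | zero => simp
    | add x y _ _ hx hy => rw [star_add]; exact add_mem hx hy
    | smul c x _ hx => rw [star_smul]; exact Submodule.smul_mem _ _ hx

theorem mem_Ped {A : Type*} [NonUnitalCStarAlgebra A] {a : A} :
    a ∈ Ped A ↔ a ∈ Submodule.span ℂ (pedPos A) := Iff.rfl

/-- The Pedersen ideal is a two-sided ideal of `A`. -/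
theorem Ped_mul_mem {A : Type*} [NonUnitalCStarAlgebra A] {x : A} (hx : x ∈ Ped A) (a : A) :
    x * a ∈ Ped A ∧ a * x ∈ Ped A := by
  refine ⟨PedersenIdeal.span_mul_mem hx a, ?_⟩
  have hs : star x ∈ Ped A := star_mem hx
  have h : star x * star a ∈ Ped A := PedersenIdeal.span_mul_mem hs (star a)
  simpa using star_mem h

/-! ## The inductive limit topology on the Pedersen ideal -/

/-- The locally convex inductive limit topology on `Ped A`: the finest locally convex vector space
topology for which the inclusion of every C*-subalgebra `D` of `A` contained in `Ped A` is
continuous, `D` having its norm topology. -/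
@[reducible] def pedTopology (A : Type*) [NonUnitalCStarAlgebra A] : TopologicalSpace (Ped A) :=
  sInf {t : TopologicalSpace (Ped A) | @IsTopologicalAddGroup (Ped A) t _ ∧
    @ContinuousSMul ℂ (Ped A) _ _ t ∧ @LocallyConvexSpace ℝ (Ped A) _ _ _ _ t ∧
    ∀ (D : NonUnitalStarSubalgebra ℂ A) (h : D ≤ Ped A), IsClosed (D : Set A) →
      Continuous[instTopologicalSpaceSubtype, t] (NonUnitalStarSubalgebra.inclusion h)}

/-- A linear functional on `Ped A` is continuous if and only if its restriction to each
C*-subalgebra contained in `Ped A` is continuous. -/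
theorem continuous_pedTopology_iff {A : Type*} [NonUnitalCStarAlgebra A] (τ : Ped A →ₗ[ℂ] ℂ) :
    Continuous[pedTopology A, _] τ ↔
      ∀ (D : NonUnitalStarSubalgebra ℂ A) (h : D ≤ Ped A), IsClosed (D : Set A) →
        Continuous fun x : D => τ (NonUnitalStarSubalgebra.inclusion h x) := by
  constructor
  · intro hτ D h hD
    have h1 : Continuous[instTopologicalSpaceSubtype, pedTopology A]
        (NonUnitalStarSubalgebra.inclusion h) :=
      continuous_sInf_rng.2 fun t ht => ht.2.2.2 D h hD
    exact @Continuous.comp _ _ _ _ (pedTopology A) _ _ _ hτ h1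
  · intro hτ
    rw [continuous_iff_le_induced]
    refine sInf_le ⟨topologicalAddGroup_induced τ, continuousSMul_induced τ,
      LocallyConvexSpace.induced (τ.restrictScalars ℝ), fun D h hD => ?_⟩
    exact continuous_induced_rng.2 (hτ D h hD)

/-! ## The real trace space -/

/-- The real vector space of continuous self-adjoint tracial linear functionals on `Ped A`. -/
def TraceSpace (A : Type*) [NonUnitalCStarAlgebra A] : Submodule ℝ (Ped A →ₗ[ℂ] ℂ) where
  carrier := {τ | Continuous[pedTopology A, _] τ ∧
    (∀ x : Ped A, τ (star x) = star (τ x)) ∧ ∀ x y : Ped A, τ (x * y) = τ (y * x)}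
  zero_mem' := by
    refine ⟨?_, by simp, by simp⟩
    rw [continuous_pedTopology_iff]
    intro D h hD
    simpa using continuous_const
  add_mem' := by
    rintro σ τ ⟨h1, h2, h3⟩ ⟨k1, k2, k3⟩
    refine ⟨?_, by simp [h2, k2], by simp [h3, k3]⟩
    rw [continuous_pedTopology_iff] at *
    exact fun D h hD => (h1 D h hD).add (k1 D h hD)
  smul_mem' := by
    rintro c τ ⟨h1, h2, h3⟩
    refine ⟨?_, by simp [h2], by simp [h3]⟩
    rw [continuous_pedTopology_iff] at *
    exact fun D h hD => (h1 D h hD).const_smul c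

/-- Evaluation of traces at the elements of `Ped A`. -/
def TraceSpace.eval (A : Type*) [NonUnitalCStarAlgebra A] : TraceSpace A →ₗ[ℝ] (Ped A → ℂ) where
  toFun τ x := τ.1 x
  map_add' _ _ := rfl
  map_smul' _ _ := rfl

/-- The weak* topology: pointwise convergence on `Ped A`. -/
noncomputable instance TraceSpace.instTopologicalSpace (A : Type*) [NonUnitalCStarAlgebra A] :
    TopologicalSpace (TraceSpace A) :=
  TopologicalSpace.induced (TraceSpace.eval A) inferInstance

instance TraceSpace.instIsTopologicalAddGroup (A : Type*) [NonUnitalCStarAlgebra A] :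
    IsTopologicalAddGroup (TraceSpace A) :=
  topologicalAddGroup_induced (TraceSpace.eval A)

instance TraceSpace.instContinuousSMul (A : Type*) [NonUnitalCStarAlgebra A] :
    ContinuousSMul ℝ (TraceSpace A) :=
  continuousSMul_induced (TraceSpace.eval A)

/-- The cone of positive traces. -/
noncomputable def TraceSpace.posCone (A : Type*) [NonUnitalCStarAlgebra A] :
    PointedCone ℝ (TraceSpace A) where
  carrier := {τ | ∀ x : Ped A, IsPos (x : A) → 0 ≤ τ.1 x}
  zero_mem' := by simp
  add_mem' := fun hσ hτ x hx => add_nonneg (hσ x hx) (hτ x hx)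
  smul_mem' := fun c _ hτ x hx => smul_nonneg c.2 (hτ x hx)

/-- The continuous dual of the trace space, with the compact-open topology. -/
abbrev TraceDual (A : Type*) [NonUnitalCStarAlgebra A] := TraceSpace A →L_c[ℝ] ℝ

/-- The cone of continuous functionals that are nonnegative on positive traces. -/
noncomputable def TraceDual.posCone (A : Type*) [NonUnitalCStarAlgebra A] :
    PointedCone ℝ (TraceDual A) where
  carrier := {f | ∀ τ ∈ TraceSpace.posCone A, 0 ≤ f τ}
  zero_mem' := fun _ _ => le_rfl
  add_mem' := fun hf hg τ hτ => add_nonneg (hf τ hτ) (hg τ hτ)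
  smul_mem' := fun c _ hf τ hτ => mul_nonneg c.2 (hf τ hτ)

/-! ## Functoriality -/

theorem Ped_map_mem {A B : Type*} [NonUnitalCStarAlgebra A] [NonUnitalCStarAlgebra B]
    (φ : A →⋆ₙₐ[ℂ] B) {a : A} (ha : a ∈ Ped A) : φ a ∈ Ped B := by
  rw [mem_Ped] at ha ⊢
  have hgen : ∀ x ∈ pedGen A, φ x ∈ pedGen B := by
    rintro x ⟨hx, e, he, hex⟩
    exact ⟨hx.map φ, φ e, he.map φ, by rw [← map_mul, hex]⟩
  have hcl : ∀ s ∈ AddSubmonoid.closure (pedGen A), φ s ∈ AddSubmonoid.closure (pedGen B) := by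
    intro s hs
    induction hs using AddSubmonoid.closure_induction with
    | mem x hx => exact AddSubmonoid.subset_closure (hgen x hx)
    | zero => simp
    | add x y _ _ hx hy => rw [map_add]; exact add_mem hx hy
  induction ha using Submodule.span_induction with
  | mem x hx =>
    obtain ⟨hp, s, hs, hsx⟩ := hx
    exact Submodule.subset_span ⟨hp.map φ, φ s, hcl s hs, by rw [← map_sub]; exact hsx.map φ⟩
  | zero => simp
  | add x y _ _ hx hy => rw [map_add]; exact add_mem hx hy
  | smul c x _ hx => rw [map_smul]; exact Submodule.smul_mem _ _ hx

/-- A *-homomorphism `A → B` maps `Ped A` to `Ped B`. -/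
def pedMap {A B : Type*} [NonUnitalCStarAlgebra A] [NonUnitalCStarAlgebra B]
    (φ : A →⋆ₙₐ[ℂ] B) : Ped A →ₗ[ℂ] Ped B where
  toFun x := ⟨φ x, Ped_map_mem φ x.2⟩
  map_add' x y := Subtype.ext (by simp)
  map_smul' c x := Subtype.ext (by simp)

theorem comp_pedMap_mem {A B : Type*} [NonUnitalCStarAlgebra A] [NonUnitalCStarAlgebra B]
    (φ : A →⋆ₙₐ[ℂ] B) (hφ : Function.Injective φ) (τ : TraceSpace B) :
    τ.1 ∘ₗ pedMap φ ∈ TraceSpace A := by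
  obtain ⟨τ, h1, h2, h3⟩ := τ
  refine ⟨?_, fun x => ?_, fun x y => ?_⟩
  · rw [continuous_pedTopology_iff] at h1 ⊢
    intro D h hD
    have hiso := NonUnitalStarAlgHom.isometry φ hφ
    have hle : D.map φ ≤ Ped B := by
      rintro _ ⟨x, hx, rfl⟩
      exact Ped_map_mem φ (h hx)
    have hcl : IsClosed (D.map φ : Set B) := hiso.isClosedEmbedding.isClosedMap _ hD
    let ψ : D → D.map φ := fun x => ⟨φ x, ⟨x, x.2, rfl⟩⟩
    have hψ : Continuous ψ := (hiso.continuous.comp continuous_subtype_val).subtype_mk _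
    exact (h1 _ hle hcl).comp hψ
  · have : pedMap φ (star x) = star (pedMap φ x) := Subtype.ext (map_star φ (x : A))
    simp only [LinearMap.comp_apply, this, h2]
  · have : ∀ x y, pedMap φ (x * y) = pedMap φ x * pedMap φ y :=
      fun x y => Subtype.ext (map_mul φ (x : A) (y : A))
    simp only [LinearMap.comp_apply, this]
    exact h3 _ _

/-- The map `τ ↦ τ ∘ φ` on trace spaces induced by an injective *-homomorphism `φ`. -/
def TraceSpace.comap {A B : Type*} [NonUnitalCStarAlgebra A] [NonUnitalCStarAlgebra B]
    (φ : A →⋆ₙₐ[ℂ] B) (hφ : Function.Injective φ) : TraceSpace B →L[ℝ] TraceSpace A where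
  toFun τ := ⟨τ.1 ∘ₗ pedMap φ, comp_pedMap_mem φ hφ τ⟩
  map_add' _ _ := rfl
  map_smul' _ _ := rfl
  cont := by
    refine continuous_induced_rng.2 (continuous_pi fun x => ?_)
    exact (continuous_apply (pedMap φ x)).comp continuous_induced_dom

/-- Restriction of traces to a C*-subalgebra. -/
noncomputable def TraceSpace.restrict {B : Type*} [NonUnitalCStarAlgebra B] (A : NonUnitalStarSubalgebra ℂ B)
    [IsClosed (A : Set B)] : TraceSpace B →L[ℝ] TraceSpace A :=
  TraceSpace.comap (NonUnitalStarSubalgebraClass.subtype A) Subtype.val_injective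

/-- The map `f ↦ f ∘ γ` on duals induced by a continuous linear map `γ` of trace spaces. -/
noncomputable def TraceDual.induced {A B : Type*} [NonUnitalCStarAlgebra A]
    [NonUnitalCStarAlgebra B] (γ : TraceSpace B →L[ℝ] TraceSpace A) :
    TraceDual A →L[ℝ] TraceDual B :=
  γ.precompCompactConvergenceCLM ℝ

/-- `f` is an isomorphism of the ordered topological vector spaces `(E, P)` and `(F, Q)`: a linear
homeomorphism that maps the positive cone `P` onto the positive cone `Q`. -/
def IsOrderedTVSIso {E F : Type*} [AddCommGroup E] [Module ℝ E] [TopologicalSpace E]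
    [AddCommGroup F] [Module ℝ F] [TopologicalSpace F]
    (P : PointedCone ℝ E) (Q : PointedCone ℝ F) (f : E →L[ℝ] F) : Prop :=
  ∃ e : E ≃L[ℝ] F, (e : E →L[ℝ] F) = f ∧ ∀ x, e x ∈ Q ↔ x ∈ P

/-- `γ` is an isomorphism of ordered topological vector spaces from the trace space of `B` to that
of `A`, and so is the induced map of duals. -/
def IsTraceIso {A B : Type*} [NonUnitalCStarAlgebra A] [NonUnitalCStarAlgebra B]
    (γ : TraceSpace B →L[ℝ] TraceSpace A) : Prop :=
  IsOrderedTVSIso (TraceSpace.posCone B) (TraceSpace.posCone A) γ ∧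
    IsOrderedTVSIso (TraceDual.posCone A) (TraceDual.posCone B) (TraceDual.induced γ)

/-! ## Full hereditary subalgebras, Morita equivalence, stabilization -/

/-- `A` is hereditary in `B` (`0 ≤ b ≤ a` with `a ∈ A` implies `b ∈ A`) and full (the closed
two-sided ideal of `B` generated by `A` is `B`). -/
structure IsFullHereditary {B : Type*} [NonUnitalCStarAlgebra B]
    (A : NonUnitalStarSubalgebra ℂ B) : Prop where
  hereditary : ∀ a ∈ A, ∀ b : B, IsPos b → IsPos (a - b) → b ∈ A
  full : Dense (TwoSidedIdeal.span (A : Set B) : Set B)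

/-- Morita equivalence of C*-algebras: `A` and `B` are isomorphic to full hereditary
C*-subalgebras of a common C*-algebra. -/
def MoritaEquivalent (A : Type u) (B : Type v) [NonUnitalCStarAlgebra A]
    [NonUnitalCStarAlgebra B] : Prop :=
  ∃ (C : Type w) (_ : NonUnitalCStarAlgebra C) (φ : A →⋆ₙₐ[ℂ] C) (ψ : B →⋆ₙₐ[ℂ] C),
    Function.Injective φ ∧ Function.Injective ψ ∧
      IsFullHereditary (NonUnitalStarAlgHom.range φ) ∧
      IsFullHereditary (NonUnitalStarAlgHom.range ψ)

section Stabilization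

variable {H : Type*} [NormedAddCommGroup H] [InnerProductSpace ℂ H]

/-- The operator on `ℓ²(ℕ, H)`, which is the Hilbert space tensor product of `H` and `ℓ²(ℕ)`, that
corresponds to the elementary tensor of `T` with the matrix unit `e i j`. -/
noncomputable def tensorUnit (i j : ℕ) (T : H →L[ℂ] H) :
    lp (fun _ : ℕ => H) 2 →L[ℂ] lp (fun _ : ℕ => H) 2 :=
  lp.singleContinuousLinearMap ℂ (fun _ : ℕ => H) 2 i ∘L T ∘L lp.evalCLM ℂ (fun _ : ℕ => H) 2 j

theorem tensorUnit_apply (i j : ℕ) (T : H →L[ℂ] H) (f : lp (fun _ : ℕ => H) 2) :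
    tensorUnit i j T f = lp.single 2 i (T (f j)) := rfl

theorem tensorUnit_mul (i : ℕ) (S T : H →L[ℂ] H) :
    tensorUnit i i (S * T) = tensorUnit i i S * tensorUnit i i T := by
  ext f : 1
  simp [tensorUnit_apply]

theorem tensorUnit_star [CompleteSpace H] (i : ℕ) (T : H →L[ℂ] H) :
    tensorUnit i i (star T) = star (tensorUnit i i T) := by
  rw [ContinuousLinearMap.star_eq_adjoint, ContinuousLinearMap.star_eq_adjoint,
    ContinuousLinearMap.eq_adjoint_iff]
  intro f g
  rw [tensorUnit_apply, tensorUnit_apply, lp.inner_single_left, lp.inner_single_right,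
    ContinuousLinearMap.adjoint_inner_left]

variable [CompleteSpace H] {A : Type*} [NonUnitalCStarAlgebra A]

/-- The spatial tensor product of `A` with the compact operators on `ℓ²(ℕ)`, where `π` represents
`A` faithfully on `H`: the C*-algebra of operators on `ℓ²(ℕ, H)` generated by the elementary
tensors of elements of `A` with matrix units. -/
noncomputable def stabilization (π : A →⋆ₙₐ[ℂ] (H →L[ℂ] H)) :
    NonUnitalStarSubalgebra ℂ (lp (fun _ : ℕ => H) 2 →L[ℂ] lp (fun _ : ℕ => H) 2) :=
  (NonUnitalStarAlgebra.adjoin ℂ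
    {T | ∃ (i j : ℕ) (a : A), T = tensorUnit i j (π a)}).topologicalClosure

instance stabilization.instIsClosed (π : A →⋆ₙₐ[ℂ] (H →L[ℂ] H)) :
    IsClosed (stabilization π :
      Set (lp (fun _ : ℕ => H) 2 →L[ℂ] lp (fun _ : ℕ => H) 2)) :=
  NonUnitalStarSubalgebra.isClosed_topologicalClosure _

/-- The corner inclusion of `A` into its stabilization, at the first matrix unit. -/
noncomputable def cornerInclusion (π : A →⋆ₙₐ[ℂ] (H →L[ℂ] H)) : A →⋆ₙₐ[ℂ] stabilization π where
  toFun a := ⟨tensorUnit 0 0 (π a), NonUnitalStarSubalgebra.le_topologicalClosure _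
    (NonUnitalStarAlgebra.subset_adjoin ℂ _ ⟨0, 0, a, rfl⟩)⟩
  map_smul' c a := by
    apply Subtype.ext
    ext f : 1
    simp [tensorUnit_apply, lp.single_smul]
  map_zero' := by
    apply Subtype.ext
    ext f : 1
    simp [tensorUnit_apply]
  map_add' a b := by
    apply Subtype.ext
    ext f : 1
    simp [tensorUnit_apply, lp.single_add]
  map_mul' a b := by
    apply Subtype.ext
    simp [tensorUnit_mul]
  map_star' a := by
    apply Subtype.ext
    simp [map_star, tensorUnit_star]

theorem cornerInclusion_injective (π : A →⋆ₙₐ[ℂ] (H →L[ℂ] H)) (hπ : Function.Injective π) :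
    Function.Injective (cornerInclusion π) := by
  intro a b hab
  apply hπ
  ext x
  have h := congrArg (fun T : stabilization π => T.1 (lp.single 2 0 x) 0) hab
  simpa [cornerInclusion, tensorUnit_apply] using h

end Stabilization

/-! Everything reduces to `IsFullHereditary.isTraceIso_comap`: an injective `φ : A → B` with full
hereditary range induces an isomorphism of trace spaces. Let J be the set of finite sums of products
p q* in B, where p and q share a right unit φ(e) with e ≥ 0 in A (`supportedIdeal`). Fullness makes
J a dense ideal, and Ped B is the smallest dense ideal (`Ped_le_of_dense`), so Ped B ⊆ J.

Uniqueness. The element q* p has φ(e) as a two-sided unit, so by heredity it comes from Ped A, and a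
trace on B takes the same value at p q* and q* p. Hence each evaluation of a trace on B is
evaluation of its restriction at one fixed element of Ped A (`exists_trace_eq`). This gives
injectivity of restriction and weak* continuity of its inverse.

Existence. A trace σ on A should extend by T(p q*) = σ(q* p). This is well defined: if ∑ c_d p_d
q_d* = 0, then u ↦ ∑ c_d σ(q_d* u p_d) is continuous and, by traciality of σ, vanishes on J, hence
on B; an approximate unit in place of u gives ∑ c_d σ(q_d* p_d) = 0 (`exists_isTransported`).
Positivity and continuity of T rest on Riesz decomposition (`exists_eq_sum_mul_star_of_le`):
whatever lies between 0 and a fixed element of J is a sum of w_i w_i*, with right units and norm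
bounds independent of it, and T(w w*) = σ(w* w). So T is positive if σ is, and bounded on order
intervals below elements of J; a linear functional on a C*-algebra bounded on order intervals is
norm bounded, which gives continuity on each C*-subalgebra of Ped B.

The statement on duals is formal. For stability, the corner of the stabilization is shown to be full
and hereditary. For Morita invariance, one restriction map is composed with the inverse of the
other. -/

namespace CStarAlgebra

/-! ### Order estimates, Riesz decomposition and automatic boundedness -/

section Order

open Filter

variable {B : Type*} [NonUnitalCStarAlgebra B] [PartialOrder B] [StarOrderedRing B]

theorem norm_le_norm_of_star_mul_le {x y : B} (h : star x * x ≤ star y * y) : ‖x‖ ≤ ‖y‖ := by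
  have h1 := norm_le_norm_of_nonneg_of_le (star_mul_self_nonneg x) h
  rw [CStarRing.norm_star_mul_self, CStarRing.norm_star_mul_self] at h1
  exact le_of_sq_le_sq (by simpa [sq] using h1) (norm_nonneg _)

theorem norm_mul_le_of_star_mul_le {x y : B} (h : star x * x ≤ star y * y) (q : B) :
    ‖x * q‖ ≤ ‖y * q‖ := by
  apply norm_le_norm_of_star_mul_le
  simpa [mul_assoc] using star_left_conjugate_le_conjugate h q

/-- This is conjugation of the inequality by 1 - q, expanded so that it stays inside the possibly
non-unital algebra. -/
theorem norm_sub_mul_le_of_star_mul_le {x y : B} (h : star x * x ≤ star y * y) (q : B) :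
    ‖x - x * q‖ ≤ ‖y - y * q‖ := by
  apply norm_le_norm_of_star_mul_le
  obtain ⟨c, hc⟩ := nonneg_iff_eq_star_mul_self.1 (sub_nonneg.2 h)
  rw [← sub_nonneg]
  have key : star (y - y * q) * (y - y * q) - star (x - x * q) * (x - x * q)
      = star (c - c * q) * (c - c * q) := by
    have e1 : ∀ d : B, star (d - d * q) * (d - d * q)
        = star d * d - star d * d * q - star q * (star d * d) + star q * (star d * d) * q := by
      intro d; simp only [star_sub, star_mul]; noncomm_ring
    rw [e1, e1, e1, ← hc]; noncomm_ring
  rw [key]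
  exact star_mul_self_nonneg _

/-- A weak form of Douglas factorization. -/
theorem exists_tendsto_mul_of_star_mul_le {z r : B} (hr : 0 ≤ r) (h : star z * z ≤ r * r) :
    ∃ y : ℕ → B, (∀ n, ‖y n‖ ≤ 1) ∧ Tendsto (fun n => y n * r) atTop (𝓝 z) := by
  have hrs : IsSelfAdjoint r := .of_nonneg hr
  have h' : star z * z ≤ star r * r := by rwa [hrs.star_eq]
  let η : ℕ → ℝ := fun n => 1 / ((n : ℝ) + 1)
  have hη : ∀ n, 0 < η n := fun n => Nat.one_div_pos_of_nat
  -- A regularized inverse: t k(t) = t²/(t² + η²) lies in [0, 1], and t - t² k(t) is at most η in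
  -- absolute value. The first bound controls the norm of z k(r), the second its defect as a
  -- solution of y r = z.
  let k : ℕ → ℝ → ℝ := fun n t => t / (t ^ 2 + η n ^ 2)
  have hpos : ∀ n t, 0 < t ^ 2 + η n ^ 2 := fun n t => by have := hη n; positivity
  have hk : ∀ n, Continuous (k n) := fun n =>
    continuous_id.div (by fun_prop) fun t => (hpos n t).ne'
  have hk0 : ∀ n, k n 0 = 0 := fun n => by simp [k]
  have hrk : ∀ n, r * cfcₙ (k n) r = cfcₙ (fun t => t * k n t) r := by
    intro n
    rw [cfcₙ_mul (fun t : ℝ => t) (k n) r (by fun_prop) rfl (hk n).continuousOn (hk0 n),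
      cfcₙ_id' ℝ r]
  have hkr : ∀ n, cfcₙ (k n) r * r = cfcₙ (fun t => t * k n t) r := by
    intro n
    have := cfcₙ_mul (k n) (fun t : ℝ => t) r (hk n).continuousOn (hk0 n) (by fun_prop) rfl
    rw [cfcₙ_id' ℝ r] at this
    rw [← this]
    simp only [mul_comm]
  have hrr : ∀ n, r - r * (cfcₙ (k n) r * r) = cfcₙ (fun t => t - t * (t * k n t)) r := by
    intro n
    have c1 : Continuous fun t => t * k n t := continuous_id.mul (hk n)
    have c2 : Continuous fun t => t * (t * k n t) := continuous_id.mul c1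
    rw [hkr, cfcₙ_sub (fun t : ℝ => t) (fun t => t * (t * k n t)) r (by fun_prop) rfl
      c2.continuousOn (by simp), cfcₙ_mul (fun t : ℝ => t) _ r (by fun_prop) rfl
      c1.continuousOn (by simp), cfcₙ_id' ℝ r]
  refine ⟨fun n => z * cfcₙ (k n) r, fun n => ?_, ?_⟩
  · refine (norm_mul_le_of_star_mul_le h' _).trans ?_
    rw [hrk]
    refine norm_cfcₙ_le fun t _ => ?_
    have e : t * k n t = t ^ 2 / (t ^ 2 + η n ^ 2) := by simp only [k]; ring
    rw [e, Real.norm_of_nonneg (div_nonneg (sq_nonneg _) (hpos n t).le), div_le_one (hpos n t)]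
    nlinarith [sq_nonneg (η n)]
  · have hlim : Tendsto η atTop (𝓝 0) := tendsto_one_div_add_atTop_nhds_zero_nat
    rw [tendsto_iff_norm_sub_tendsto_zero]
    refine squeeze_zero (fun _ => norm_nonneg _) (fun n => ?_) hlim
    rw [norm_sub_rev, mul_assoc]
    refine (norm_sub_mul_le_of_star_mul_le h' _).trans ?_
    rw [hrr]
    refine norm_cfcₙ_le fun t _ => ?_
    have e : t - t * (t * k n t) = η n * (η n * t / (t ^ 2 + η n ^ 2)) := by
      have := (hpos n t).ne'
      simp only [k]; field_simp; ring
    rw [e, norm_mul, Real.norm_of_nonneg (hη n).le]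
    refine mul_le_of_le_one_right (hη n).le ?_
    rw [Real.norm_eq_abs, abs_div, abs_of_pos (hpos n t), div_le_one (hpos n t), abs_le]
    constructor <;> nlinarith [sq_nonneg (η n + t), sq_nonneg (η n - t), sq_nonneg t, sq_nonneg (η n)]

/-- Riesz decomposition: an element dominated by `∑ v v*` is of the form `∑ w w*`, where each `w`
is a limit of elements `y v` with `‖y‖ ≤ 1`. -/
theorem exists_eq_sum_mul_star_of_le {ι : Type*} [Fintype ι] (v : ι → B) {x : B} (hx : 0 ≤ x)
    (hle : x ≤ ∑ i, v i * star (v i)) :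
    ∃ w : ι → B, (∀ i, ‖w i‖ ≤ ‖v i‖ ∧ ∀ e, v i * e = v i → w i * e = w i) ∧
      x = ∑ i, w i * star (w i) := by
  set s := ∑ i, v i * star (v i) with hs
  have hs0 : 0 ≤ s := hx.trans hle
  set r := CFC.sqrt s
  have hr : 0 ≤ r := CFC.sqrt_nonneg s
  have hrr : r * r = s := CFC.sqrt_mul_sqrt_self s
  set z := CFC.sqrt x
  have hz : star z = z := (IsSelfAdjoint.of_nonneg (CFC.sqrt_nonneg x)).star_eq
  have hzz : z * z = x := CFC.sqrt_mul_sqrt_self x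
  obtain ⟨y, hy1, hy⟩ := exists_tendsto_mul_of_star_mul_le hr (z := z) (by rwa [hz, hzz, hrr])
  -- Since v_i v_i* ≤ r², convergence of y_n r forces y_n v_i to be Cauchy; the limits are the
  -- required w_i.
  have hnorm : ∀ (c : B) i, ‖c * v i‖ ≤ ‖c * r‖ := by
    intro c i
    have h1 : v i * star (v i) ≤ s :=
      Finset.single_le_sum (f := fun i => v i * star (v i))
        (fun i _ => mul_star_self_nonneg (v i)) (Finset.mem_univ i)
    have h2 := norm_mul_le_of_star_mul_le (x := star (v i)) (y := r)
      (by rw [star_star, (IsSelfAdjoint.of_nonneg hr).star_eq, hrr]; exact h1) (star c)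
    rw [← norm_star (c * v i), ← norm_star (c * r), star_mul, star_mul,
      (IsSelfAdjoint.of_nonneg hr).star_eq]
    exact h2
  have hcau : ∀ i, CauchySeq fun n => y n * v i := by
    intro i
    have hc := hy.cauchySeq
    rw [Metric.cauchySeq_iff] at hc ⊢
    intro ε hε
    obtain ⟨N, hN⟩ := hc ε hε
    refine ⟨N, fun m hm n hn => lt_of_le_of_lt ?_ (hN m hm n hn)⟩
    rw [dist_eq_norm, dist_eq_norm, ← sub_mul, ← sub_mul]
    exact hnorm _ _
  choose w hw using fun i => cauchySeq_tendsto_of_complete (hcau i)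
  refine ⟨w, fun i => ⟨le_of_tendsto (hw i).norm (.of_forall fun n => ?_), fun e he => ?_⟩, ?_⟩
  · exact (norm_mul_le _ _).trans (mul_le_of_le_one_left (norm_nonneg _) (hy1 n))
  · refine tendsto_nhds_unique ((hw i).mul_const e) ?_
    simpa only [mul_assoc, he] using hw i
  · have h1 : Tendsto (fun n => ∑ i, (y n * v i) * star (y n * v i)) atTop
        (𝓝 (∑ i, w i * star (w i))) :=
      tendsto_finsetSum _ fun i _ => (hw i).mul (hw i).star
    have h2 : Tendsto (fun n => (y n * r) * star (y n * r)) atTop (𝓝 (z * star z)) := hy.mul hy.star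
    rw [hz, hzz] at h2
    -- Both sequences agree: ∑ (y_n v_i)(y_n v_i)* = y_n s y_n* = (y_n r)(y_n r)*.
    refine tendsto_nhds_unique h2 (h1.congr fun n => ?_)
    rw [star_mul, (IsSelfAdjoint.of_nonneg hr).star_eq, mul_assoc, ← mul_assoc r, hrr, hs,
      Finset.sum_mul, Finset.mul_sum]
    simp [mul_assoc]

/-- With r the root of a, the product (r e - r)* (r e - r) expands to e a e - e a - a e + a = 0. -/
theorem sqrt_mul_eq_self {a e : B} (ha : 0 ≤ a) (he : IsSelfAdjoint e) (h : e * a = a) :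
    CFC.sqrt a * e = CFC.sqrt a := by
  set r := CFC.sqrt a
  have hr : star r = r := (IsSelfAdjoint.of_nonneg (CFC.sqrt_nonneg a)).star_eq
  have hrr : r * r = a := CFC.sqrt_mul_sqrt_self a
  have h' : a * e = a := by
    have := congrArg star h
    rwa [star_mul, he.star_eq, (IsSelfAdjoint.of_nonneg ha).star_eq] at this
  have : star (r * e - r) * (r * e - r) = 0 := by
    simp only [star_sub, star_mul, hr, he.star_eq]
    calc (e * r - r) * (r * e - r) = e * (r * r) * e - e * (r * r) - (r * r) * e + r * r := by
          noncomm_ring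
      _ = 0 := by rw [hrr, h, h']; abel
  exact sub_eq_zero.1 (CStarRing.star_mul_self_eq_zero_iff _ |>.1 this)

/-- Positive elements are approximated by positive elements with a positive unit. -/
theorem exists_norm_sub_le_mul_eq_self {x : B} (hx : 0 ≤ x) {ε : ℝ} (hε : 0 < ε) :
    ∃ a e : B, 0 ≤ a ∧ 0 ≤ e ∧ e * a = a ∧ ‖x - a‖ ≤ ε := by
  have hxs : IsSelfAdjoint x := .of_nonneg hx
  -- f moves the spectrum down by ε and cuts it off at 0; g equals 1 wherever f is nonzero, so g f =
  -- f.
  let f : ℝ → ℝ := fun t => max (t - ε) 0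
  let g : ℝ → ℝ := fun t => min (|t| / ε) 1
  have hf : Continuous f := by fun_prop
  have hg : Continuous g := by fun_prop
  have hf0 : f 0 = 0 := by simp [f, hε.le]
  have hg0 : g 0 = 0 := by simp [g]
  refine ⟨cfcₙ f x, cfcₙ g x, cfcₙ_nonneg fun t _ => le_max_right _ _,
    cfcₙ_nonneg fun t _ => le_min (by positivity) zero_le_one, ?_, ?_⟩
  · rw [← cfcₙ_mul g f x hg.continuousOn hg0 hf.continuousOn hf0]
    congr 1
    funext t
    simp only [f, g]
    rcases le_total t ε with h | h
    · rw [max_eq_right (sub_nonpos.2 h), mul_zero]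
    · have : 1 ≤ |t| / ε := by rw [le_div_iff₀ hε, one_mul]; exact h.trans (le_abs_self t)
      rw [min_eq_right this, one_mul]
  · have : x - cfcₙ f x = cfcₙ (fun t => t - f t) x := by
      rw [cfcₙ_sub (fun t : ℝ => t) f x (by fun_prop) rfl hf.continuousOn hf0, cfcₙ_id' ℝ x]
    rw [this]
    refine norm_cfcₙ_le fun t ht => ?_
    have ht0 : 0 ≤ t := quasispectrum_nonneg_of_nonneg x hx t ht
    simp only [f]
    rcases le_total t ε with h | h
    · rw [max_eq_right (sub_nonpos.2 h), sub_zero, Real.norm_of_nonneg ht0]; exact h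
    · rw [max_eq_left (sub_nonneg.2 h), sub_sub_cancel, Real.norm_of_nonneg hε.le]

/-- A functional that is bounded on order intervals of positive elements is bounded. -/
theorem exists_norm_apply_le_of_bounded_Icc (f : B →ₗ[ℂ] ℂ)
    (hf : ∀ d : B, 0 ≤ d → ∃ K : ℝ, ∀ x, 0 ≤ x → x ≤ d → ‖f x‖ ≤ K) :
    ∃ C : ℝ, ∀ x, ‖f x‖ ≤ C * ‖x‖ := by
  suffices h_nonneg : ∃ C : ℝ, ∀ a, 0 ≤ a → ‖f a‖ ≤ C * ‖a‖ by
    obtain ⟨C, hmain⟩ := h_nonneg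
    refine ⟨4 * |C|, fun x ↦ ?_⟩
    obtain ⟨y, hy_nonneg, hy_norm, hy⟩ := CStarAlgebra.exists_sum_four_nonneg x
    conv_lhs => rw [hy]
    simp only [map_sum, map_smul]
    apply norm_sum_le _ _ |>.trans
    simp only [norm_smul, norm_pow, Complex.norm_I, one_pow, one_mul]
    apply Finset.sum_le_sum (g := fun _ ↦ |C| * ‖x‖) (fun i _ ↦ ?_) |>.trans <| by simp [mul_assoc]
    apply hmain _ (hy_nonneg i) |>.trans
    gcongr
    · exact le_abs_self C
    · exact hy_norm i
  -- If no bound exists, there are positive y_n of norm 2⁻ⁿ with |f(y_n)| > n. Their sum d converges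
  -- and dominates every y_n, so f is unbounded on the interval from 0 to d.
  by_contra! hcontra
  choose x hx0 hx using fun n : ℕ => hcontra (n * 2 ^ n)
  have hne : ∀ n, 0 < ‖x n‖ := fun n => (norm_nonneg _).lt_of_ne' fun h => by
    have := hx n
    rw [norm_eq_zero.1 h] at this
    simp at this
  let y : ℕ → B := fun n => ((2 ^ n : ℝ)⁻¹ * ‖x n‖⁻¹) • x n
  have hy0 : ∀ n, 0 ≤ y n := fun n => smul_nonneg (by positivity) (hx0 n)
  have hyn : ∀ n, ‖y n‖ = (2⁻¹ : ℝ) ^ n := fun n => by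
    rw [norm_smul, Real.norm_of_nonneg (by positivity), mul_assoc, inv_mul_cancel₀ (hne n).ne',
      mul_one, inv_pow]
  have hsum : Summable y := Summable.of_norm (by
    simp only [hyn]; exact summable_geometric_of_lt_one (by norm_num) (by norm_num))
  obtain ⟨K, hK⟩ := hf (∑' n, y n) (tsum_nonneg hy0)
  obtain ⟨n, hn⟩ := exists_nat_gt K
  have h1 := hK (y n) (hy0 n) (hsum.le_tsum n fun m _ => hy0 m)
  have h2 : (n : ℝ) < ‖f (y n)‖ := by
    have e : f (y n) = ((2 ^ n : ℝ)⁻¹ * ‖x n‖⁻¹) • f (x n) := by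
      simp only [y]
      rw [← Complex.coe_smul, map_smul, Complex.coe_smul]
    rw [e, norm_smul, Real.norm_of_nonneg (by positivity), ← mul_inv, lt_inv_mul_iff₀]
    · have := hx n
      linarith
    · have := hne n; positivity
  linarith

end Order

/-- Elements with a left unit lie in all dense ideals. -/
theorem mem_of_mul_eq_self {B : Type*} [NonUnitalCStarAlgebra B] (I : Submodule ℂ B)
    (hI : Dense (I : Set B)) (hl : ∀ b, ∀ x ∈ I, b * x ∈ I) (hr : ∀ b, ∀ x ∈ I, x * b ∈ I)
    {e x : B} (h : e * x = x) : x ∈ I := by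
  -- Since e x = x, the invertible g = 1 - (e - y) of the unitization satisfies g x = y x, so x =
  -- g⁻¹ y x lies in the ideal.
  obtain ⟨y, hyI, hy⟩ := hI.exists_dist_lt e one_pos
  rw [dist_eq_norm] at hy
  have hy' : ‖(Unitization.inr (e - y) : Unitization ℂ B)‖ < 1 := by rwa [Unitization.norm_inr]
  let g := Units.oneSub (Unitization.inr (e - y) : Unitization ℂ B) hy'
  have hg : (g : Unitization ℂ B) * Unitization.inr x = Unitization.inr (y * x) := by
    rw [Units.val_oneSub, sub_mul, one_mul, ← Unitization.inr_mul, ← Unitization.inr_sub, sub_mul, h,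
      sub_sub_cancel]
  have hx : (Unitization.inr x : Unitization ℂ B) = ((g⁻¹ : (Unitization ℂ B)ˣ) : Unitization ℂ B)
      * Unitization.inr (y * x) := by
    rw [← hg, Units.inv_mul_cancel_left]
  set k := ((g⁻¹ : (Unitization ℂ B)ˣ) : Unitization ℂ B)
  have : x = k.fst • (y * x) + k.snd * (y * x) := by
    apply Unitization.inr_injective (R := ℂ)
    rw [hx]
    ext <;> simp
  rw [this]
  have hyx := hr x y hyI
  exact add_mem (I.smul_mem _ hyx) (hl _ _ hyx)

end CStarAlgebra

/-! ### The Pedersen ideal as smallest dense ideal, and the ideal of supported products -/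

section Ideal

variable {A B : Type*} [NonUnitalCStarAlgebra A] [NonUnitalCStarAlgebra B]

/-- The elements `p q*` of `B` for which `p` and `q` have a common positive right unit in the image
of `φ`. -/
def supportedProducts (φ : A →⋆ₙₐ[ℂ] B) : Set B :=
  {x | ∃ (p q : B) (e : A), IsPos e ∧ p * φ e = p ∧ q * φ e = q ∧ x = p * star q}

/-- The ideal of finite sums of elements of `supportedProducts φ`. -/
def supportedIdeal (φ : A →⋆ₙₐ[ℂ] B) : Submodule ℂ B where
  __ := AddSubmonoid.closure (supportedProducts φ)
  smul_mem' := by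
    intro c x hx
    change x ∈ AddSubmonoid.closure _ at hx
    change _ ∈ AddSubmonoid.closure _
    induction hx using AddSubmonoid.closure_induction with
    | mem x hx =>
      obtain ⟨p, q, e, he, hp, hq, rfl⟩ := hx
      exact AddSubmonoid.subset_closure
        ⟨c • p, q, e, he, by rw [smul_mul_assoc, hp], hq, by rw [smul_mul_assoc]⟩
    | zero => simp
    | add x y _ _ hx hy => rw [smul_add]; exact add_mem hx hy

theorem mem_supportedIdeal {φ : A →⋆ₙₐ[ℂ] B} {x : B} :
    x ∈ supportedIdeal φ ↔ x ∈ AddSubmonoid.closure (supportedProducts φ) := Iff.rfl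

theorem mul_star_mem_supportedIdeal (φ : A →⋆ₙₐ[ℂ] B) {p q : B} {e : A} (he : IsPos e)
    (hp : p * φ e = p) (hq : q * φ e = q) : p * star q ∈ supportedIdeal φ :=
  AddSubmonoid.subset_closure ⟨p, q, e, he, hp, hq, rfl⟩

theorem mul_mem_supportedIdeal (φ : A →⋆ₙₐ[ℂ] B) (b : B) :
    ∀ x ∈ supportedIdeal φ, b * x ∈ supportedIdeal φ := by
  intro x hx
  rw [mem_supportedIdeal] at hx
  induction hx using AddSubmonoid.closure_induction with
  | mem x hx =>
    obtain ⟨p, q, e, he, hp, hq, rfl⟩ := hx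
    rw [← mul_assoc]
    exact mul_star_mem_supportedIdeal φ he (by rw [mul_assoc, hp]) hq
  | zero => simp
  | add x y _ _ hx hy => rw [mul_add]; exact add_mem hx hy

theorem mem_supportedIdeal_mul (φ : A →⋆ₙₐ[ℂ] B) (b : B) :
    ∀ x ∈ supportedIdeal φ, x * b ∈ supportedIdeal φ := by
  intro x hx
  rw [mem_supportedIdeal] at hx
  induction hx using AddSubmonoid.closure_induction with
  | mem x hx =>
    obtain ⟨p, q, e, he, hp, hq, rfl⟩ := hx
    have : p * star q * b = p * star (star b * q) := by simp [mul_assoc]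
    rw [this]
    exact mul_star_mem_supportedIdeal φ he hp (by rw [mul_assoc, hq])
  | zero => simp
  | add x y _ _ hx hy => rw [add_mul]; exact add_mem hx hy

theorem IsPos.mul_eq_self_comm {e a : A} (he : IsPos e) (ha : star a = a) :
    e * a = a ↔ a * e = a := by
  constructor <;> intro h <;> simpa [he.star_eq, ha] using congrArg star h

theorem continuous_starHom (φ : A →⋆ₙₐ[ℂ] B) : Continuous φ :=
  AddMonoidHomClass.continuous_of_bound φ 1 fun x => by
    simpa using NonUnitalStarAlgHom.norm_apply_le φ x

theorem exists_pedGen_norm_sub_le {x : A} (hx : IsPos x) {ε : ℝ} (hε : 0 < ε) :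
    ∃ a ∈ pedGen A, ‖x - a‖ ≤ ε := by
  let _ := CStarAlgebra.spectralOrder A
  have := CStarAlgebra.spectralOrderedRing A
  obtain ⟨a, e, ha, he, hea, h⟩ :=
    CStarAlgebra.exists_norm_sub_le_mul_eq_self ((isPos_iff_nonneg x).1 hx) hε
  exact ⟨a, ⟨(isPos_iff_nonneg a).2 ha, e, (isPos_iff_nonneg e).2 he, hea⟩, h⟩

theorem mem_closure_pedGen {x : A} (hx : IsPos x) : x ∈ closure (pedGen A) := by
  rw [Metric.mem_closure_iff]
  intro ε hε
  obtain ⟨a, ha, h⟩ := exists_pedGen_norm_sub_le hx (half_pos hε)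
  exact ⟨a, ha, by rw [dist_eq_norm]; linarith⟩

theorem span_isPos : Submodule.span ℂ {x : A | IsPos x} = ⊤ := by
  let _ := CStarAlgebra.spectralOrder A
  have := CStarAlgebra.spectralOrderedRing A
  rw [eq_top_iff]
  intro x _
  obtain ⟨y, hy, -, hx⟩ := CStarAlgebra.exists_sum_four_nonneg x
  rw [hx]
  exact sum_mem fun i _ => Submodule.smul_mem _ _
    (Submodule.subset_span ((isPos_iff_nonneg _).2 (hy i)))

theorem IsPos.exists_mul_self {x : A} (hx : IsPos x) : ∃ y : A, IsPos y ∧ y * y = x := by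
  let _ := CStarAlgebra.spectralOrder A
  have := CStarAlgebra.spectralOrderedRing A
  exact ⟨CFC.sqrt x, (isPos_iff_nonneg _).2 (CFC.sqrt_nonneg x),
    CFC.sqrt_mul_sqrt_self x ((isPos_iff_nonneg x).1 hx)⟩

/-- A positive x is y², and y is a limit of positive a having a unit e; then φ(a²) = φ(a) φ(a)* is a
supported product. So the closure, which is an ideal, contains the range of φ, and fullness
finishes. -/
theorem dense_supportedIdeal (φ : A →⋆ₙₐ[ℂ] B)
    (hφ : Dense (TwoSidedIdeal.span (Set.range φ) : Set B)) :
    Dense (supportedIdeal φ : Set B) := by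
  set K := (supportedIdeal φ).topologicalClosure with hK
  have hKc : IsClosed (K : Set B) := (supportedIdeal φ).isClosed_topologicalClosure
  have hpos : ∀ x : A, IsPos x → φ x ∈ K := by
    intro x hx
    obtain ⟨y, hy, rfl⟩ := hx.exists_mul_self
    have hcl : IsClosed {a : A | φ (a * a) ∈ K} :=
      hKc.preimage ((continuous_starHom φ).comp (continuous_id.mul continuous_id))
    refine closure_minimal ?_ hcl (mem_closure_pedGen hy)
    rintro a ⟨ha, e, he, hea⟩
    refine (supportedIdeal φ).le_topologicalClosure ?_
    have h1 : φ a * φ e = φ a := by rw [← map_mul, (he.mul_eq_self_comm ha.star_eq).1 hea]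
    have := mul_star_mem_supportedIdeal φ he h1 h1
    rwa [← map_star, ha.star_eq, ← map_mul] at this
  have hrange : ∀ x : A, φ x ∈ K := by
    intro x
    have hx : x ∈ Submodule.span ℂ {x : A | IsPos x} := by rw [span_isPos]; trivial
    induction hx using Submodule.span_induction with
    | mem x hx => exact hpos x hx
    | zero => simp
    | add x y _ _ hx hy => rw [map_add]; exact add_mem hx hy
    | smul c x _ hx => rw [map_smul]; exact K.smul_mem c hx
  have hl : ∀ b x, x ∈ K → b * x ∈ K := fun b x hx =>
    map_mem_closure (continuous_const_mul b) hx (mul_mem_supportedIdeal φ b)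
  have hr : ∀ x b, x ∈ K → x * b ∈ K := fun x b hx =>
    map_mem_closure (f := (· * b)) (continuous_mul_const b) hx (mem_supportedIdeal_mul φ b)
  let T : TwoSidedIdeal B := TwoSidedIdeal.mk' K K.zero_mem (fun h h' => K.add_mem h h')
    (fun h => K.neg_mem h) (fun {b x} h => hl b x h) (fun {x b} h => hr x b h)
  have hT : (T : Set B) = K := TwoSidedIdeal.coe_mk' _ _ _ _ _ _
  have hle : TwoSidedIdeal.span (Set.range φ) ≤ T := by
    rw [TwoSidedIdeal.span_le, hT]
    rintro _ ⟨x, rfl⟩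
    exact hrange x
  have hKd : Dense (K : Set B) := hφ.mono (by rw [← hT]; exact hle)
  rw [dense_iff_closure_eq] at hKd ⊢
  rwa [hKc.closure_eq, hK, Submodule.topologicalClosure_coe] at hKd

theorem dense_span_range_id : Dense (TwoSidedIdeal.span
    (Set.range (NonUnitalStarAlgHom.id ℂ A)) : Set A) := fun x =>
  subset_closure (TwoSidedIdeal.subset_span ⟨x, rfl⟩)

theorem pedGen_subset_pedPos : pedGen A ⊆ pedPos A := fun a ha =>
  ⟨ha.1, a, AddSubmonoid.subset_closure ha, by rw [sub_self]; exact IsPos.zero⟩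

theorem pedGen_subset_Ped : pedGen A ⊆ Ped A := fun _ ha =>
  Submodule.subset_span (pedGen_subset_pedPos ha)

theorem dense_Ped : Dense (Ped A : Set A) := by
  intro x
  change x ∈ ((Ped A).toSubmodule.topologicalClosure : Set A)
  have hx : x ∈ Submodule.span ℂ {x : A | IsPos x} := by rw [span_isPos]; trivial
  exact Submodule.span_le.2 (fun y hy => closure_mono pedGen_subset_Ped (mem_closure_pedGen hy)) hx

theorem mem_Ped_of_mul_eq_self {e x : A} (h : e * x = x) : x ∈ Ped A :=
  CStarAlgebra.mem_of_mul_eq_self (Ped A).toSubmodule dense_Ped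
    (fun b _ hx => (Ped_mul_mem hx b).2) (fun b _ hx => (Ped_mul_mem hx b).1) h

/-- A sum of elements `v v*` is a sum over a finite family. -/
theorem exists_eq_sum_mul_star (Q : B → Prop) {s : B}
    (hs : s ∈ AddSubmonoid.closure {x | ∃ v, Q v ∧ x = v * star v}) :
    ∃ (n : ℕ) (v : Fin n → B), (∀ i, Q (v i)) ∧ s = ∑ i, v i * star (v i) := by
  induction hs using AddSubmonoid.closure_induction with
  | mem x hx =>
    obtain ⟨v, hv, rfl⟩ := hx
    exact ⟨1, fun _ => v, fun _ => hv, by simp⟩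
  | zero => exact ⟨0, Fin.elim0, fun i => i.elim0, by simp⟩
  | add x y _ _ hx hy =>
    obtain ⟨m, v, hv, rfl⟩ := hx
    obtain ⟨n, w, hw, rfl⟩ := hy
    refine ⟨m + n, Fin.append v w, fun i => ?_, ?_⟩
    · refine Fin.addCases (fun i => ?_) (fun i => ?_) i
      · rw [Fin.append_left]; exact hv i
      · rw [Fin.append_right]; exact hw i
    · simp [Fin.sum_univ_add]

theorem IsPos.exists_eq_sum_mul_star {ι : Type*} [Fintype ι] (v : ι → B) {x : B} (hx : IsPos x)
    (hle : IsPos ((∑ i, v i * star (v i)) - x)) :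
    ∃ w : ι → B, (∀ i, ‖w i‖ ≤ ‖v i‖ ∧ ∀ e, v i * e = v i → w i * e = w i) ∧
      x = ∑ i, w i * star (w i) := by
  let _ := CStarAlgebra.spectralOrder B
  have := CStarAlgebra.spectralOrderedRing B
  rw [isPos_iff_nonneg] at hx hle
  exact CStarAlgebra.exists_eq_sum_mul_star_of_le v hx (sub_nonneg.1 hle)

/-- The Pedersen ideal is the smallest dense ideal. -/
theorem Ped_le_of_dense (I : Submodule ℂ B) (hI : Dense (I : Set B))
    (hl : ∀ b, ∀ x ∈ I, b * x ∈ I) (hr : ∀ b, ∀ x ∈ I, x * b ∈ I) : (Ped B).toSubmodule ≤ I := by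
  refine Submodule.span_le.2 ?_
  rintro x ⟨hx, s, hs, hsx⟩
  -- A generator a with e a = a is v v* for v its square root, and v inherits e as right unit.
  have hs' : s ∈ AddSubmonoid.closure {x : B | ∃ v, (∃ e, IsPos e ∧ v * e = v) ∧ x = v * star v} := by
    refine AddSubmonoid.closure_mono ?_ hs
    rintro a ⟨ha, e, he, hea⟩
    let _ := CStarAlgebra.spectralOrder B
    have := CStarAlgebra.spectralOrderedRing B
    have ha' := (isPos_iff_nonneg a).1 ha
    refine ⟨CFC.sqrt a, ⟨e, he, CStarAlgebra.sqrt_mul_eq_self ha' he.star_eq hea⟩, ?_⟩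
    rw [(IsSelfAdjoint.of_nonneg (CFC.sqrt_nonneg a)).star_eq, CFC.sqrt_mul_sqrt_self a ha']
  obtain ⟨n, v, hv, rfl⟩ := exists_eq_sum_mul_star _ hs'
  obtain ⟨w, hw, rfl⟩ := hx.exists_eq_sum_mul_star v hsx
  -- Riesz decomposition preserves right units, so w_i* has a left unit and lies in every dense
  -- ideal.
  refine sum_mem fun i _ => hl _ _ ?_
  obtain ⟨e, he, hve⟩ := hv i
  refine CStarAlgebra.mem_of_mul_eq_self I hI hl hr (e := e) ?_
  have := congrArg star ((hw i).2 e hve)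
  rwa [star_mul, he.star_eq] at this

theorem mem_supportedIdeal_of_mem_Ped (φ : A →⋆ₙₐ[ℂ] B)
    (hφ : Dense (TwoSidedIdeal.span (Set.range φ) : Set B)) {x : B} (hx : x ∈ Ped B) :
    x ∈ supportedIdeal φ :=
  Ped_le_of_dense _ (dense_supportedIdeal φ hφ) (mul_mem_supportedIdeal φ)
    (mem_supportedIdeal_mul φ) hx

/-- The elements for which `e` is a two-sided unit. -/
def unitSubalgebra (e : A) (he : IsPos e) : NonUnitalStarSubalgebra ℂ A where
  carrier := {x | e * x = x ∧ x * e = x}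
  zero_mem' := by simp
  add_mem' := fun {x y} hx hy => by
    change e * (x + y) = x + y ∧ (x + y) * e = x + y
    rw [mul_add, add_mul, hx.1, hy.1, hx.2, hy.2]; simp
  mul_mem' := fun {x y} hx hy => by
    change e * (x * y) = x * y ∧ (x * y) * e = x * y
    rw [← mul_assoc, hx.1, mul_assoc, hy.2]; simp
  smul_mem' := fun c x hx => by
    change e * (c • x) = c • x ∧ (c • x) * e = c • x
    rw [mul_smul_comm, hx.1, smul_mul_assoc, hx.2]; simp
  star_mem' := fun {x} hx => by
    have h1 := congrArg star hx.1
    have h2 := congrArg star hx.2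
    rw [star_mul, he.star_eq] at h1 h2
    exact ⟨h2, h1⟩

/-- The elements with two-sided unit e form a C*-subalgebra contained in Ped A, on which continuity
means a norm bound. The extension argument uses the continuity of σ only through this bound. -/
theorem TraceSpace.exists_norm_apply_le (σ : TraceSpace A) {e : A} (he : IsPos e) :
    ∃ C : ℝ, ∀ (x : Ped A), e * (x : A) = x → (x : A) * e = x → ‖σ.1 x‖ ≤ C * ‖(x : A)‖ := by
  have hle : unitSubalgebra e he ≤ Ped A := fun x hx => mem_Ped_of_mul_eq_self hx.1
  have hcl : IsClosed (unitSubalgebra e he : Set A) :=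
    (isClosed_eq (continuous_const_mul e) continuous_id).inter
      (isClosed_eq (continuous_mul_const e) continuous_id)
  have hc := (continuous_pedTopology_iff σ.1).1 σ.2.1 _ hle hcl
  let f : unitSubalgebra e he →L[ℂ] ℂ :=
    { toFun := fun x => σ.1 (NonUnitalStarSubalgebra.inclusion hle x)
      map_add' := fun x y => by rw [map_add, map_add]
      map_smul' := fun c x => by rw [map_smul, map_smul]; rfl
      cont := hc }
  exact ⟨‖f‖, fun x h1 h2 => f.le_opNorm ⟨x, h1, h2⟩⟩

theorem TraceSpace.apply_mul_comm (σ : TraceSpace A) {x y : A} (hx : x ∈ Ped A) (hy : y ∈ Ped A) :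
    σ.1 ⟨x * y, mul_mem hx hy⟩ = σ.1 ⟨y * x, mul_mem hy hx⟩ :=
  σ.2.2.2 ⟨x, hx⟩ ⟨y, hy⟩

end Ideal

/-! ### Heredity of the range and uniqueness of extensions of traces -/

section Hereditary

variable {A B : Type*} [NonUnitalCStarAlgebra A] [NonUnitalCStarAlgebra B] {φ : A →⋆ₙₐ[ℂ] B}

theorem IsFullHereditary.dense_span_range (h : IsFullHereditary (NonUnitalStarAlgHom.range φ)) :
    Dense (TwoSidedIdeal.span (Set.range φ) : Set B) := by
  simpa using h.full

/-- For b ≥ 0 one has c* b c ≤ ‖b‖ c* c, so heredity applies; a general b is a combination of four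
positive elements. -/
theorem IsFullHereditary.star_mul_mul_mem (h : IsFullHereditary (NonUnitalStarAlgHom.range φ))
    (c : A) (b : B) : star (φ c) * b * φ c ∈ NonUnitalStarAlgHom.range φ := by
  let _ := CStarAlgebra.spectralOrder B
  have := CStarAlgebra.spectralOrderedRing B
  have hpos : ∀ b : B, 0 ≤ b → star (φ c) * b * φ c ∈ NonUnitalStarAlgHom.range φ := by
    intro b hb
    have hm : (‖b‖ : ℂ) • (star (φ c) * φ c) ∈ NonUnitalStarAlgHom.range φ :=
      SMulMemClass.smul_mem _ (mul_mem (star_mem ⟨c, rfl⟩) ⟨c, rfl⟩)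
    refine h.hereditary _ hm _ ((isPos_iff_nonneg _).2 (star_left_conjugate_nonneg hb _)) ?_
    rw [isPos_iff_nonneg, sub_nonneg, Complex.coe_smul]
    exact CStarAlgebra.star_left_conjugate_le_norm_smul (.of_nonneg hb)
  obtain ⟨y, hy, -, hb⟩ := CStarAlgebra.exists_sum_four_nonneg b
  rw [hb, Finset.mul_sum, Finset.sum_mul]
  refine sum_mem fun i _ => ?_
  rw [mul_smul_comm, smul_mul_assoc]
  exact SMulMemClass.smul_mem _ (hpos _ (hy i))

/-- Polarization of the case a = c*. -/
theorem IsFullHereditary.mul_mul_mem (h : IsFullHereditary (NonUnitalStarAlgHom.range φ))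
    (a c : A) (b : B) : φ a * b * φ c ∈ NonUnitalStarAlgHom.range φ := by
  have h1 := h.star_mul_mul_mem (c + star a) b
  have h2 := h.star_mul_mul_mem (c + Complex.I • star a) b
  have h3 := h.star_mul_mul_mem (c - star a) b
  have h4 := h.star_mul_mul_mem (c - Complex.I • star a) b
  have key : φ a * b * φ c = (1 / 4 : ℂ) • ((star (φ (c + star a)) * b * φ (c + star a)
      - star (φ (c - star a)) * b * φ (c - star a))
      + Complex.I • (star (φ (c + Complex.I • star a)) * b * φ (c + Complex.I • star a)
      - star (φ (c - Complex.I • star a)) * b * φ (c - Complex.I • star a))) := by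
    simp only [map_add, map_sub, map_smul, map_star, star_add, star_sub, star_star, star_smul,
      add_mul, mul_add, sub_mul, mul_sub, smul_mul_assoc, mul_smul_comm]
    match_scalars <;> simp <;> ring_nf <;> simp; norm_num
  rw [key]
  exact SMulMemClass.smul_mem _ (add_mem (sub_mem h1 h3) (SMulMemClass.smul_mem _ (sub_mem h2 h4)))

theorem IsFullHereditary.exists_of_mul_eq_self
    (h : IsFullHereditary (NonUnitalStarAlgHom.range φ)) {e f : A} {b : B} (h1 : φ e * b = b)
    (h2 : b * φ f = b) : ∃ a, φ a = b := by
  have := h.mul_mul_mem e f b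
  rw [h1, h2] at this
  exact this

/-- Every element of `Ped B` agrees, on traces, with an element of `Ped A`. -/
theorem IsFullHereditary.exists_trace_eq (h : IsFullHereditary (NonUnitalStarAlgHom.range φ))
    (hφ : Function.Injective φ) (x : Ped B) :
    ∃ y : Ped A, ∀ τ : TraceSpace B, τ.1 x = τ.1 (pedMap φ y) := by
  suffices ∀ x ∈ supportedIdeal φ, ∃ y : Ped A, ∃ hx : x ∈ Ped B,
      ∀ τ : TraceSpace B, τ.1 ⟨x, hx⟩ = τ.1 (pedMap φ y) by
    obtain ⟨y, _, hy⟩ := this x (mem_supportedIdeal_of_mem_Ped φ h.dense_span_range x.2)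
    exact ⟨y, hy⟩
  intro x hx
  rw [mem_supportedIdeal] at hx
  induction hx using AddSubmonoid.closure_induction with
  | mem x hx =>
    obtain ⟨p, q, e, he, hp, hq, rfl⟩ := hx
    have hp' : φ e * star p = star p := by
      simpa [(he.map φ).star_eq] using congrArg star hp
    have hq' : φ e * star q = star q := by
      simpa [(he.map φ).star_eq] using congrArg star hq
    have hpP : p ∈ Ped B := by simpa using star_mem (mem_Ped_of_mul_eq_self hp')
    have hqP : star q ∈ Ped B := mem_Ped_of_mul_eq_self hq'
    -- The trace exchanges p q* for q* p, which has φ(e) as a two-sided unit and therefore comes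
    -- from A.
    have h1 : φ e * (star q * p) = star q * p := by rw [← mul_assoc, hq']
    obtain ⟨a, ha⟩ := h.exists_of_mul_eq_self h1 (by rw [mul_assoc, hp])
    have hea : e * a = a := hφ (by rw [map_mul, ha, h1])
    refine ⟨⟨a, mem_Ped_of_mul_eq_self hea⟩, mul_mem hpP hqP, fun τ => ?_⟩
    rw [TraceSpace.apply_mul_comm τ hpP hqP]
    congr 1
    exact Subtype.ext ha.symm
  | zero => exact ⟨0, zero_mem _, fun τ => by rw [map_zero, map_zero]; exact map_zero τ.1⟩
  | add x y _ _ hx hy =>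
    obtain ⟨a, hxP, ha⟩ := hx
    obtain ⟨b, hyP, hb⟩ := hy
    refine ⟨a + b, add_mem hxP hyP, fun τ => ?_⟩
    rw [map_add, map_add, ← ha, ← hb, ← map_add]
    rfl

end Hereditary

/-! ### Existence, continuity and positivity of extensions of traces -/

section Extension

open Filter

variable {A B : Type*} [NonUnitalCStarAlgebra A] [NonUnitalCStarAlgebra B] {φ : A →⋆ₙₐ[ℂ] B}

/-- `t` is a linear extension to `B` of the functional `σ ∘ φ⁻¹` on the image of `Ped A`. -/
def ExtendsTrace (φ : A →⋆ₙₐ[ℂ] B) (σ : TraceSpace A) (t : B →ₗ[ℂ] ℂ) : Prop :=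
  ∀ x : Ped A, t (φ x) = σ.1 x

/-- A purely algebraic extension. Its values off the image of Ped A are arbitrary and play no role;
a functional on all of B merely avoids carrying membership proofs. -/
theorem exists_extendsTrace (hφ : Function.Injective φ) (σ : TraceSpace A) :
    ∃ t : B →ₗ[ℂ] ℂ, ExtendsTrace φ σ t := by
  let f : Ped A →ₗ[ℂ] B := (φ : A →ₗ[ℂ] B) ∘ₗ (Ped A).toSubmodule.subtype
  have hf : LinearMap.ker f = ⊥ := LinearMap.ker_eq_bot.2 fun x y h => Subtype.ext (hφ h)
  obtain ⟨g, hg⟩ := f.exists_leftInverse_of_injective hf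
  exact ⟨σ.1 ∘ₗ g, fun x => congrArg σ.1 (LinearMap.congr_fun hg x)⟩

/-- A functional `T` on `B` such that `T (p q*) = t (q* p)` whenever `p` and `q` have a common
positive right unit in the image of `φ`. -/
def IsTransported (φ : A →⋆ₙₐ[ℂ] B) (t T : B →ₗ[ℂ] ℂ) : Prop :=
  ∀ (p q : B) (e : A), IsPos e → p * φ e = p → q * φ e = q → T (p * star q) = t (star q * p)

variable (h : IsFullHereditary (NonUnitalStarAlgHom.range φ)) (hφ : Function.Injective φ)
  {σ : TraceSpace A} {t T : B →ₗ[ℂ] ℂ} (ht : ExtendsTrace φ σ t)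

theorem IsPos.map_mul_star_eq_self {e : A} (he : IsPos e) {p : B} (hp : p * φ e = p) :
    φ e * star p = star p := by
  simpa [(he.map φ).star_eq] using congrArg star hp

include h hφ in
theorem IsFullHereditary.exists_mem_Ped {e f : A} {b : B} (h1 : φ e * b = b)
    (h2 : b * φ f = b) : ∃ a : Ped A, φ a = b ∧ e * (a : A) = a ∧ (a : A) * f = a := by
  obtain ⟨a, ha⟩ := h.exists_of_mul_eq_self h1 h2
  have hea : e * a = a := hφ (by rw [map_mul, ha, h1])
  have haf : a * f = a := hφ (by rw [map_mul, ha, h2])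
  exact ⟨⟨a, mem_Ped_of_mul_eq_self hea⟩, ha, hea, haf⟩

include h hφ ht

theorem ExtendsTrace.exists_norm_le {e : A} (he : IsPos e) :
    ∃ C : ℝ, 0 ≤ C ∧ ∀ x : B, φ e * x = x → x * φ e = x → ‖t x‖ ≤ C * ‖x‖ := by
  obtain ⟨C, hC⟩ := TraceSpace.exists_norm_apply_le σ he
  refine ⟨|C|, abs_nonneg C, fun x h1 h2 => ?_⟩
  obtain ⟨a, rfl, h3, h4⟩ := h.exists_mem_Ped hφ h1 h2
  rw [ht a, (NonUnitalStarAlgHom.isometry φ hφ).norm_map_of_map_zero (map_zero φ)]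
  exact (hC a h3 h4).trans (by gcongr; exact le_abs_self C)

theorem ExtendsTrace.tendsto {e : A} (he : IsPos e) {X : Type*} {l : Filter X} {z : X → B} {z₀ : B}
    (hz : Tendsto z l (𝓝 z₀)) (hz1 : ∀ i, φ e * z i = z i ∧ z i * φ e = z i)
    (hz2 : φ e * z₀ = z₀ ∧ z₀ * φ e = z₀) : Tendsto (fun i => t (z i)) l (𝓝 (t z₀)) := by
  obtain ⟨C, -, hC⟩ := ht.exists_norm_le h hφ he
  rw [tendsto_iff_norm_sub_tendsto_zero] at hz ⊢
  refine squeeze_zero (fun _ => norm_nonneg _) (fun i => ?_) (by simpa using hz.const_mul C)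
  rw [← map_sub]
  exact hC _ (by rw [mul_sub, (hz1 i).1, hz2.1]) (by rw [sub_mul, (hz1 i).2, hz2.2])

theorem ExtendsTrace.mul_comm {e f : A} {x y : B} (h1 : φ e * x = x) (h2 : x * φ f = x)
    (h3 : φ f * y = y) (h4 : y * φ e = y) : t (x * y) = t (y * x) := by
  obtain ⟨a, rfl, -, -⟩ := h.exists_mem_Ped hφ h1 h2
  obtain ⟨b, rfl, -, -⟩ := h.exists_mem_Ped hφ h3 h4
  rw [← map_mul, ← map_mul]
  exact (ht (a * b)).trans ((σ.2.2.2 a b).trans (ht (b * a)).symm)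

theorem ExtendsTrace.exists_isTransported : ∃ T : B →ₗ[ℂ] ℂ, IsTransported φ t T := by
  let G := {d : B × B // ∃ e : A, IsPos e ∧ d.1 * φ e = d.1 ∧ d.2 * φ e = d.2}
  let P : (G →₀ ℂ) →ₗ[ℂ] B := Finsupp.linearCombination ℂ fun d : G => d.1.1 * star d.1.2
  let Q : (G →₀ ℂ) →ₗ[ℂ] ℂ := Finsupp.linearCombination ℂ fun d : G => t (star d.1.2 * d.1.1)
  have hker : ∀ f, P f = 0 → Q f = 0 := by
    intro f hf
    -- Inserting u in the middle makes density usable: for fixed d, q_d* u p_d stays in the corner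
    -- of a single e, where t is norm continuous, so S is continuous.
    let S : B → ℂ := fun u => ∑ d ∈ f.support, f d * t (star d.1.2 * u * d.1.1)
    have hd : ∀ (d : G) (e : A) (u : B), IsPos e → d.1.1 * φ e = d.1.1 → d.1.2 * φ e = d.1.2 →
        φ e * (star d.1.2 * u * d.1.1) = star d.1.2 * u * d.1.1 ∧
        star d.1.2 * u * d.1.1 * φ e = star d.1.2 * u * d.1.1 := by
      intro d e u he h1 h2
      rw [← mul_assoc, ← mul_assoc, he.map_mul_star_eq_self h2, mul_assoc _ d.1.1, h1]
      exact ⟨rfl, rfl⟩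
    have hSc : Continuous S := by
      refine continuous_finsetSum _ fun d _ => continuous_const.mul ?_
      obtain ⟨e, he, h1, h2⟩ := d.2
      refine continuous_iff_continuousAt.2 fun u => ?_
      refine ht.tendsto h hφ he ?_ (fun u => hd d e u he h1 h2) (hd d e u he h1 h2)
      exact Continuous.tendsto (f := fun u => star d.1.2 * u * d.1.1) (by fun_prop) u
    have hSadd : ∀ x y, S (x + y) = S x + S y := by
      intro x y
      simp only [S, mul_add, add_mul, map_add, Finset.sum_add_distrib]
    have hS0 : ∀ u ∈ supportedIdeal φ, S u = 0 := by
      intro u hu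
      rw [mem_supportedIdeal] at hu
      induction hu using AddSubmonoid.closure_induction with
      | mem x hx =>
        obtain ⟨p, q, e, he, hp, hq, rfl⟩ := hx
        -- Traciality swaps q_d* p and q* p_d, which come from A by their one-sided units e' and e;
        -- then the sum over d reassembles P f = 0.
        have h1 : S (p * star q) = t (star q * P f * p) := by
          simp only [P, Finsupp.linearCombination_apply, Finsupp.sum, Finset.mul_sum,
            Finset.sum_mul, map_sum, S]
          refine Finset.sum_congr rfl fun d _ => ?_
          obtain ⟨e', he', h1, h2⟩ := d.2
          rw [mul_smul_comm, smul_mul_assoc, map_smul, smul_eq_mul]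
          congr 1
          have := ht.mul_comm h hφ (e := e') (f := e) (x := star d.1.2 * p) (y := star q * d.1.1)
            (by rw [← mul_assoc, he'.map_mul_star_eq_self h2]) (by rw [mul_assoc, hp])
            (by rw [← mul_assoc, he.map_mul_star_eq_self hq]) (by rw [mul_assoc, h1])
          simpa only [mul_assoc] using this
        rw [h1, hf, mul_zero, zero_mul, map_zero]
      | zero => simp [S]
      | add x y _ _ hx hy => rw [hSadd, hx, hy, add_zero]
    have hSz : ∀ u, S u = 0 := by
      intro u
      exact closure_minimal (s := (supportedIdeal φ : Set B)) (t := {u | S u = 0}) hS0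
        (isClosed_eq hSc continuous_const) (dense_supportedIdeal φ h.dense_span_range u)
    let _ := CStarAlgebra.spectralOrder B
    have := CStarAlgebra.spectralOrderedRing B
    have hau := CStarAlgebra.increasingApproximateUnit B
    -- Letting u run through an approximate unit removes it and recovers Q f.
    have hlim : Tendsto S (CStarAlgebra.approximateUnit B) (𝓝 (Q f)) := by
      simp only [Q, Finsupp.linearCombination_apply, Finsupp.sum, smul_eq_mul]
      refine tendsto_finsetSum _ fun d _ => Tendsto.const_mul _ ?_
      obtain ⟨e, he, h1, h2⟩ := d.2
      refine ht.tendsto h hφ he ((hau.tendsto_mul_left (star d.1.2)).mul_const d.1.1)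
        (fun u => hd d e u he h1 h2) ?_
      rw [← mul_assoc, he.map_mul_star_eq_self h2, mul_assoc, h1]
      exact ⟨rfl, rfl⟩
    exact tendsto_nhds_unique hlim (tendsto_const_nhds.congr fun u => (hSz u).symm)
  -- A functional vanishing on the kernel of P factors through P, and over a field the factor
  -- extends to all of B.
  have hQ : Q ∈ LinearMap.range P.dualMap := by
    rw [LinearMap.range_dualMap_eq_dualAnnihilator_ker, Submodule.mem_dualAnnihilator]
    exact fun f hf => hker f hf
  obtain ⟨T, hT⟩ := hQ
  refine ⟨T, fun p q e he hp hq => ?_⟩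
  have := LinearMap.congr_fun hT (Finsupp.single ⟨(p, q), e, he, hp, hq⟩ 1)
  simpa [P, Q] using this

omit h hφ in
-- Applied to the identity of A, the inclusion of Ped in the supported ideal writes x as a sum of p
-- q* inside A, where σ(p q*) = σ(q* p).
theorem IsTransported.apply_map (hT : IsTransported φ t T) (x : Ped A) : T (φ x) = σ.1 x := by
  suffices ∀ x ∈ supportedIdeal (NonUnitalStarAlgHom.id ℂ A), ∃ hx : x ∈ Ped A,
      T (φ x) = σ.1 ⟨x, hx⟩ by
    obtain ⟨_, hx⟩ := this x (mem_supportedIdeal_of_mem_Ped _ dense_span_range_id x.2)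
    exact hx
  intro x hx
  rw [mem_supportedIdeal] at hx
  induction hx using AddSubmonoid.closure_induction with
  | mem x hx =>
    obtain ⟨p, q, e, he, hp, hq, rfl⟩ := hx
    change p * e = p at hp
    change q * e = q at hq
    have hpP : p ∈ Ped A := by
      have h1 : e * star p = star p := by simpa [he.star_eq] using congrArg star hp
      simpa using star_mem (mem_Ped_of_mul_eq_self h1)
    have hqP : star q ∈ Ped A :=
      mem_Ped_of_mul_eq_self (by simpa [he.star_eq] using congrArg star hq)
    refine ⟨mul_mem hpP hqP, ?_⟩
    rw [TraceSpace.apply_mul_comm σ hpP hqP, ← ht, map_mul φ, map_star φ,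
      hT (φ p) (φ q) e he (by rw [← map_mul, hp]) (by rw [← map_mul, hq]), map_mul φ, map_star φ]
  | zero => exact ⟨zero_mem _, by rw [map_zero, map_zero]; exact (map_zero σ.1).symm⟩
  | add x y _ _ hx hy =>
    obtain ⟨hxP, hx⟩ := hx
    obtain ⟨hyP, hy⟩ := hy
    refine ⟨add_mem hxP hyP, ?_⟩
    rw [map_add, map_add, hx, hy, ← map_add]
    rfl

omit h hφ ht in
-- For x = p q*, both sides equal t(q* y p): the factor y is absorbed into q on one side and into p
-- on the other, without changing right units.
theorem IsTransported.mul_comm (hT : IsTransported φ t T) {x : B} (hx : x ∈ supportedIdeal φ)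
    (y : B) : T (x * y) = T (y * x) := by
  rw [mem_supportedIdeal] at hx
  induction hx using AddSubmonoid.closure_induction with
  | mem x hx =>
    obtain ⟨p, q, e, he, hp, hq, rfl⟩ := hx
    have h1 := hT p (star y * q) e he hp (by rw [mul_assoc, hq])
    have h2 := hT (y * p) q e he (by rw [mul_assoc, hp]) hq
    simp only [star_mul, star_star, mul_assoc] at h1 h2 ⊢
    rw [h1, h2]
  | zero => simp
  | add x y _ _ hx hy => rw [add_mul, mul_add, map_add, map_add, hx, hy]

theorem IsTransported.apply_star (hT : IsTransported φ t T) {x : B} (hx : x ∈ supportedIdeal φ) :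
    T (star x) = star (T x) := by
  rw [mem_supportedIdeal] at hx
  induction hx using AddSubmonoid.closure_induction with
  | mem x hx =>
    obtain ⟨p, q, e, he, hp, hq, rfl⟩ := hx
    obtain ⟨a, ha, -, -⟩ := h.exists_mem_Ped hφ (e := e) (f := e) (b := star q * p)
      (by rw [← mul_assoc, he.map_mul_star_eq_self hq]) (by rw [mul_assoc, hp])
    have h3 : star p * q = φ (star a : Ped A) := by
      change _ = φ (star (a : A))
      rw [map_star, ha, star_mul, star_star]
    rw [star_mul, star_star, hT p q e he hp hq, hT q p e he hq hp, h3, ht, ← ha, ht]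
    exact σ.2.2.1 a
  | zero => simp
  | add x y _ _ hx hy => rw [star_add, map_add, map_add, hx, hy, star_add]

omit h hφ ht in
theorem exists_family_of_mem_supportedIdeal {x : B} (hx : x ∈ supportedIdeal φ) :
    ∃ (n : ℕ) (v : Fin n → B), (∀ i, ∃ e : A, IsPos e ∧ v i * φ e = v i) ∧
      IsPos ((∑ i, v i * star (v i)) - (x + star x)) := by
  suffices ∃ s ∈ AddSubmonoid.closure {x : B | ∃ v, (∃ e : A, IsPos e ∧ v * φ e = v) ∧
      x = v * star v}, IsPos (s - (x + star x)) by
    obtain ⟨s, hs, hsx⟩ := this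
    obtain ⟨n, v, hv, rfl⟩ := exists_eq_sum_mul_star _ hs
    exact ⟨n, v, hv, hsx⟩
  rw [mem_supportedIdeal] at hx
  induction hx using AddSubmonoid.closure_induction with
  | mem x hx =>
    obtain ⟨p, q, e, he, hp, hq, rfl⟩ := hx
    -- p p* + q q* - (p q* + q p*) = (p - q)(p - q)* ≥ 0.
    refine ⟨p * star p + q * star q, add_mem (AddSubmonoid.subset_closure ⟨p, ⟨e, he, hp⟩, rfl⟩)
      (AddSubmonoid.subset_closure ⟨q, ⟨e, he, hq⟩, rfl⟩), star (p - q), ?_⟩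
    simp only [star_sub, star_mul, star_star]
    noncomm_ring
  | zero => exact ⟨0, zero_mem _, by simpa using IsPos.zero⟩
  | add x y _ _ hx hy =>
    obtain ⟨s, hs, hsx⟩ := hx
    obtain ⟨r, hr, hry⟩ := hy
    refine ⟨s + r, add_mem hs hr, ?_⟩
    have := hsx.add hry
    rw [star_add]
    convert this using 1
    abel

omit h hφ ht in
/-- The positive elements below an element of `supportedIdeal φ` have uniform decompositions. -/
theorem exists_family_of_isPos_sub {x : B} (hx : x ∈ supportedIdeal φ) :
    ∃ (n : ℕ) (v : Fin n → B), (∀ i, ∃ e : A, IsPos e ∧ v i * φ e = v i) ∧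
      ∀ z : B, IsPos z → IsPos (x - z) → ∃ w : Fin n → B,
        (∀ i, ‖w i‖ ≤ ‖v i‖ ∧ ∀ e, v i * e = v i → w i * e = w i) ∧
        z = ∑ i, w i * star (w i) := by
  obtain ⟨n, v, hv, hvx⟩ := exists_family_of_mem_supportedIdeal hx
  refine ⟨n, v, hv, fun z hz hxz => hz.exists_eq_sum_mul_star v ?_⟩
  have hxp : IsPos x := by simpa using hxz.add hz
  rw [hxp.star_eq] at hvx
  -- With s the sum of the v_i v_i*: s - z = (s - 2x) + x + (x - z).
  have := (hvx.add hxp).add hxz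
  convert this using 1
  abel

/-- Write z = ∑ w_i w_i*. Then T(w_i w_i*) = t(w_i* w_i), where w_i* w_i lies in the corner of an
e_i independent of z and has norm at most ‖v_i‖². -/
theorem IsTransported.exists_norm_le (hT : IsTransported φ t T) {x : B}
    (hx : x ∈ supportedIdeal φ) :
    ∃ K : ℝ, ∀ z, IsPos z → IsPos (x - z) → ‖T z‖ ≤ K := by
  obtain ⟨n, v, hv, hvx⟩ := exists_family_of_isPos_sub hx
  choose e he hve using hv
  choose C hC0 hC using fun i => ht.exists_norm_le h hφ (he i)
  refine ⟨∑ i, C i * (‖v i‖ * ‖v i‖), fun z hz hxz => ?_⟩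
  obtain ⟨w, hw, rfl⟩ := hvx z hz hxz
  rw [map_sum]
  refine (norm_sum_le _ _).trans (Finset.sum_le_sum fun i _ => ?_)
  have hwe := (hw i).2 _ (hve i)
  rw [hT (w i) (w i) (e i) (he i) hwe hwe]
  refine (hC i _ (by rw [← mul_assoc, (he i).map_mul_star_eq_self hwe])
    (by rw [mul_assoc, hwe])).trans ?_
  rw [CStarRing.norm_star_mul_self]
  have := hC0 i
  have := (hw i).1
  gcongr

theorem IsTransported.nonneg (hT : IsTransported φ t T) (hσ : σ ∈ TraceSpace.posCone A) {x : B}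
    (hx : x ∈ supportedIdeal φ) (hxp : IsPos x) : 0 ≤ T x := by
  obtain ⟨n, v, hv, hvx⟩ := exists_family_of_isPos_sub hx
  obtain ⟨w, hw, rfl⟩ := hvx x hxp (by rw [sub_self]; exact IsPos.zero)
  rw [map_sum]
  refine Finset.sum_nonneg fun i _ => ?_
  obtain ⟨e, he, hve⟩ := hv i
  have hwe := (hw i).2 _ hve
  rw [hT (w i) (w i) e he hwe hwe]
  have h1 : φ e * (star (w i) * w i) = star (w i) * w i := by
    rw [← mul_assoc, he.map_mul_star_eq_self hwe]
  -- Positivity of w* w is needed in A, not only in B. Its square root also has unit φ(e), so by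
  -- heredity the root itself comes from A.
  obtain ⟨r, hr, hrr⟩ : ∃ r : B, r * r = star (w i) * w i ∧ (star r = r ∧ r * φ e = r) := by
    let _ := CStarAlgebra.spectralOrder B
    have := CStarAlgebra.spectralOrderedRing B
    have h0 := star_mul_self_nonneg (w i)
    exact ⟨CFC.sqrt (star (w i) * w i), CFC.sqrt_mul_sqrt_self _ h0,
      (IsSelfAdjoint.of_nonneg (CFC.sqrt_nonneg _)).star_eq,
      CStarAlgebra.sqrt_mul_eq_self h0 (he.map φ).star_eq h1⟩
  obtain ⟨hrs, hre⟩ := hrr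
  obtain ⟨a, ha, -, -⟩ := h.exists_mem_Ped hφ
    (by simpa [hrs] using he.map_mul_star_eq_self hre) hre
  have h2 : star (w i) * w i = φ (star a * a : Ped A) := by
    change _ = φ (star (a : A) * a)
    rw [map_mul, map_star, ha, hrs, hr]
  rw [h2, ht]
  exact hσ _ ⟨a, rfl⟩

omit ht in
theorem IsFullHereditary.exists_comap_eq (σ : TraceSpace A) :
    ∃ τ : TraceSpace B, TraceSpace.comap φ hφ τ = σ ∧
      (σ ∈ TraceSpace.posCone A → τ ∈ TraceSpace.posCone B) := by
  obtain ⟨t, ht⟩ := exists_extendsTrace hφ σ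
  obtain ⟨T, hT⟩ := ht.exists_isTransported h hφ
  have hJ : ∀ x : Ped B, (x : B) ∈ supportedIdeal φ := fun x =>
    mem_supportedIdeal_of_mem_Ped φ h.dense_span_range x.2
  refine ⟨⟨T ∘ₗ (Ped B).toSubmodule.subtype, ?_, fun x => ?_, fun x y => ?_⟩, ?_, ?_⟩
  · rw [continuous_pedTopology_iff]
    intro D hD hDc
    -- Positivity in D implies positivity in B, so an order interval of D sits inside one of B below
    -- an element of Ped B, where T is bounded.
    let _ := CStarAlgebra.spectralOrder D
    have := CStarAlgebra.spectralOrderedRing D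
    let f : D →ₗ[ℂ] ℂ := T ∘ₗ D.toSubmodule.subtype
    obtain ⟨C, hC⟩ := CStarAlgebra.exists_norm_apply_le_of_bounded_Icc f fun d hd => by
      obtain ⟨K, hK⟩ := hT.exists_norm_le h hφ ht (hJ ⟨d, hD d.2⟩)
      refine ⟨K, fun x hx hxd => hK x ?_ ?_⟩
      · exact ((isPos_iff_nonneg x).2 hx).map (NonUnitalStarSubalgebraClass.subtype D)
      · exact ((isPos_iff_nonneg _).2 (sub_nonneg.2 hxd)).map
          (NonUnitalStarSubalgebraClass.subtype D)
    exact AddMonoidHomClass.continuous_of_bound f C hC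
  · exact hT.apply_star h hφ ht (hJ x)
  · exact hT.mul_comm (hJ x) y
  · refine Subtype.ext (LinearMap.ext fun x => ?_)
    exact hT.apply_map ht x
  · exact fun hσ x hx => hT.nonneg h hφ ht hσ (hJ x) hx

end Extension

/-! ### Isomorphisms of ordered trace spaces and their duals -/

section Isomorphisms

theorem IsOrderedTVSIso.symm {E F : Type*} [AddCommGroup E] [Module ℝ E] [TopologicalSpace E]
    [AddCommGroup F] [Module ℝ F] [TopologicalSpace F] {P : PointedCone ℝ E} {Q : PointedCone ℝ F}
    (e : E ≃L[ℝ] F) (he : ∀ x, e x ∈ Q ↔ x ∈ P) :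
    IsOrderedTVSIso Q P (e.symm : F →L[ℝ] E) :=
  ⟨e.symm, rfl, fun y => by rw [← he, e.apply_symm_apply]⟩

theorem IsOrderedTVSIso.comp {E F G : Type*} [AddCommGroup E] [Module ℝ E] [TopologicalSpace E]
    [AddCommGroup F] [Module ℝ F] [TopologicalSpace F] [AddCommGroup G] [Module ℝ G]
    [TopologicalSpace G] {P : PointedCone ℝ E} {Q : PointedCone ℝ F} {R : PointedCone ℝ G}
    {g : F →L[ℝ] G} {f : E →L[ℝ] F} (hg : IsOrderedTVSIso Q R g) (hf : IsOrderedTVSIso P Q f) :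
    IsOrderedTVSIso P R (g ∘L f) := by
  obtain ⟨e, rfl, he⟩ := hf
  obtain ⟨d, rfl, hd⟩ := hg
  exact ⟨e.trans d, rfl, fun x => (hd _).trans (he x)⟩

/-- The map on duals induced by an isomorphism of ordered trace spaces is an isomorphism. -/
theorem IsOrderedTVSIso.isTraceIso {A B : Type*} [NonUnitalCStarAlgebra A]
    [NonUnitalCStarAlgebra B] {γ : TraceSpace B →L[ℝ] TraceSpace A}
    (hγ : IsOrderedTVSIso (TraceSpace.posCone B) (TraceSpace.posCone A) γ) : IsTraceIso γ := by
  refine ⟨hγ, ?_⟩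
  obtain ⟨e, rfl, he⟩ := hγ
  refine ⟨ContinuousLinearEquiv.equivOfInverse
    (TraceDual.induced (e : TraceSpace B →L[ℝ] TraceSpace A))
    (TraceDual.induced (e.symm : TraceSpace A →L[ℝ] TraceSpace B)) (fun f => ?_) (fun f => ?_),
    rfl, fun f => ⟨fun hf τ hτ => ?_, fun hf τ hτ => hf _ ((he τ).2 hτ)⟩⟩
  · ext τ
    exact congrArg f (e.apply_symm_apply τ)
  · ext τ
    exact congrArg f (e.symm_apply_apply τ)
  · have h1 : 0 ≤ f (e (e.symm τ)) := hf (e.symm τ) ((he _).1 (by rwa [e.apply_symm_apply]))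
    rwa [e.apply_symm_apply] at h1

variable {A B : Type*} [NonUnitalCStarAlgebra A] [NonUnitalCStarAlgebra B]

/-- The embedding of a full hereditary subalgebra induces an isomorphism of trace spaces. -/
theorem IsFullHereditary.isTraceIso_comap {φ : A →⋆ₙₐ[ℂ] B}
    (h : IsFullHereditary (NonUnitalStarAlgHom.range φ)) (hφ : Function.Injective φ) :
    IsTraceIso (TraceSpace.comap φ hφ) := by
  have hinj : Function.Injective (TraceSpace.comap φ hφ) := by
    intro τ τ' hτ
    refine Subtype.ext (LinearMap.ext fun x => ?_)
    obtain ⟨y, hy⟩ := h.exists_trace_eq hφ x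
    rw [hy τ, hy τ']
    exact LinearMap.congr_fun (congrArg Subtype.val hτ) y
  choose ext hext hpos using fun σ => h.exists_comap_eq hφ σ
  let e : TraceSpace B ≃ₗ[ℝ] TraceSpace A :=
    LinearEquiv.ofBijective (TraceSpace.comap φ hφ : TraceSpace B →ₗ[ℝ] TraceSpace A)
      ⟨hinj, fun σ => ⟨ext σ, hext σ⟩⟩
  have hsymm : ∀ σ, e.symm σ = ext σ := fun σ => by
    rw [LinearEquiv.symm_apply_eq]; exact (hext σ).symm
  -- For each x the extension of σ takes the value σ(y) at x, with y independent of σ.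
  have hcont : Continuous e.symm := by
    refine continuous_induced_rng.2 (continuous_pi fun x => ?_)
    obtain ⟨y, hy⟩ := h.exists_trace_eq hφ x
    have h1 : Continuous fun σ : TraceSpace A => σ.1 y :=
      (continuous_apply y).comp continuous_induced_dom
    refine h1.congr fun σ => ?_
    change σ.1 y = (e.symm σ).1 x
    rw [hsymm, hy]
    exact LinearMap.congr_fun (congrArg Subtype.val (hext σ).symm) y
  refine IsOrderedTVSIso.isTraceIso ⟨⟨e, (TraceSpace.comap φ hφ).continuous, hcont⟩, rfl,
    fun τ => ⟨fun hτ => ?_, fun hτ x hx => hτ _ (hx.map φ)⟩⟩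
  have h1 := hpos _ hτ
  have h2 : ext (TraceSpace.comap φ hφ τ) = τ := hinj (hext _)
  change ext (TraceSpace.comap φ hφ τ) ∈ _ at h1
  rwa [h2] at h1

end Isomorphisms

/-! ### The corner of the stabilization is full and hereditary -/

section Stabilization

variable {H : Type*} [NormedAddCommGroup H] [InnerProductSpace ℂ H]

theorem tensorUnit_mul_same (i j k : ℕ) (S T : H →L[ℂ] H) :
    tensorUnit i j S * tensorUnit j k T = tensorUnit i k (S * T) := by
  ext f : 1
  simp [tensorUnit_apply]

theorem tensorUnit_mul_of_ne (i l : ℕ) {j k : ℕ} (hjk : j ≠ k) (S T : H →L[ℂ] H) :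
    tensorUnit i j S * tensorUnit k l T = 0 := by
  ext f : 1
  simp [tensorUnit_apply, hjk]

theorem star_tensorUnit [CompleteSpace H] (i j : ℕ) (T : H →L[ℂ] H) :
    star (tensorUnit i j T) = tensorUnit j i (star T) := by
  symm
  rw [ContinuousLinearMap.star_eq_adjoint, ContinuousLinearMap.star_eq_adjoint,
    ContinuousLinearMap.eq_adjoint_iff]
  intro f g
  rw [tensorUnit_apply, tensorUnit_apply, lp.inner_single_left, lp.inner_single_right,
    ContinuousLinearMap.adjoint_inner_left]

theorem tensorUnit_smul (i j : ℕ) (c : ℂ) (T : H →L[ℂ] H) :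
    tensorUnit i j (c • T) = c • tensorUnit i j T := by
  ext f : 1
  simp [tensorUnit_apply, lp.single_smul]

theorem tensorUnit_add (i j : ℕ) (S T : H →L[ℂ] H) :
    tensorUnit i j (S + T) = tensorUnit i j S + tensorUnit i j T := by
  ext f : 1
  simp [tensorUnit_apply, lp.single_add]

theorem continuous_tensorUnit (i j : ℕ) :
    Continuous (tensorUnit i j : (H →L[ℂ] H) → _) := by
  unfold tensorUnit
  fun_prop

variable [CompleteSpace H] {A : Type*} [NonUnitalCStarAlgebra A] (π : A →⋆ₙₐ[ℂ] (H →L[ℂ] H))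

/-- The linear span of the tensors of elements of `A` with matrix units. -/
noncomputable def tensorSpan : Submodule ℂ (lp (fun _ : ℕ => H) 2 →L[ℂ] lp (fun _ : ℕ => H) 2) :=
  Submodule.span ℂ {T | ∃ (i j : ℕ) (a : A), T = tensorUnit i j (π a)}

/-- By the matrix unit relations the span is already closed under products and adjoints. -/
theorem mem_tensorSpan_of_mem_adjoin {T : lp (fun _ : ℕ => H) 2 →L[ℂ] lp (fun _ : ℕ => H) 2}
    (hT : T ∈ NonUnitalStarAlgebra.adjoin ℂ {T | ∃ (i j : ℕ) (a : A), T = tensorUnit i j (π a)}) :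
    T ∈ tensorSpan π := by
  have hmul : ∀ x ∈ tensorSpan π, ∀ y ∈ tensorSpan π, x * y ∈ tensorSpan π := by
    intro x hx y hy
    induction hx, hy using Submodule.span_induction₂ with
    | mem_mem x y hx hy =>
      obtain ⟨i, j, a, rfl⟩ := hx
      obtain ⟨k, l, b, rfl⟩ := hy
      by_cases hjk : j = k
      · subst hjk
        rw [tensorUnit_mul_same, ← map_mul]
        exact Submodule.subset_span ⟨i, l, a * b, rfl⟩
      · rw [tensorUnit_mul_of_ne _ _ hjk]; exact zero_mem _
    | zero_left y _ => simp
    | zero_right x _ => simp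
    | add_left x y z _ _ _ h1 h2 => rw [add_mul]; exact add_mem h1 h2
    | add_right x y z _ _ _ h1 h2 => rw [mul_add]; exact add_mem h1 h2
    | smul_left c x y _ _ h1 => rw [smul_mul_assoc]; exact Submodule.smul_mem _ _ h1
    | smul_right c x y _ _ h1 => rw [mul_smul_comm]; exact Submodule.smul_mem _ _ h1
  have hstar : ∀ x ∈ tensorSpan π, star x ∈ tensorSpan π := by
    intro x hx
    induction hx using Submodule.span_induction with
    | mem x hx =>
      obtain ⟨i, j, a, rfl⟩ := hx
      rw [star_tensorUnit, ← map_star]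
      exact Submodule.subset_span ⟨j, i, star a, rfl⟩
    | zero => simp
    | add x y _ _ hx hy => rw [star_add]; exact add_mem hx hy
    | smul c x _ hx => rw [star_smul]; exact Submodule.smul_mem _ _ hx
  let S : NonUnitalStarSubalgebra ℂ (lp (fun _ : ℕ => H) 2 →L[ℂ] lp (fun _ : ℕ => H) 2) :=
    { tensorSpan π with
      mul_mem' := fun {x y} hx hy => hmul x hx y hy
      star_mem' := fun {x} hx => hstar x hx }
  have : NonUnitalStarAlgebra.adjoin ℂ {T | ∃ (i j : ℕ) (a : A), T = tensorUnit i j (π a)} ≤ S :=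
    NonUnitalStarAlgebra.adjoin_le fun x hx => Submodule.subset_span hx
  exact this hT

theorem dense_preimage_tensorSpan :
    Dense {T : stabilization π | (T : lp (fun _ : ℕ => H) 2 →L[ℂ] lp (fun _ : ℕ => H) 2) ∈
      tensorSpan π} := by
  intro T
  rw [closure_subtype]
  refine closure_mono ?_ T.2
  intro S hS
  exact ⟨⟨S, NonUnitalStarSubalgebra.le_topologicalClosure _ hS⟩,
    mem_tensorSpan_of_mem_adjoin π hS, rfl⟩

/-- Compression by the first diagonal matrix unit maps the stabilization to the corner. -/
theorem tensorUnit_mul_mul_mem_range (hπ : Function.Injective π) (T : stabilization π) :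
    ∃ a, tensorUnit 0 0 (1 : H →L[ℂ] H) * T.1 * tensorUnit 0 0 (1 : H →L[ℂ] H)
      = tensorUnit 0 0 (π a) := by
  -- An injective *-homomorphism is isometric, so the corner is closed; compression being
  -- continuous, it suffices to compress the dense span.
  have hcl : IsClosed (Set.range (cornerInclusion π)) :=
    (NonUnitalStarAlgHom.isometry _ (cornerInclusion_injective π hπ)).isClosedEmbedding.isClosed_range
  have hcl' : IsClosed (Subtype.val '' Set.range (cornerInclusion π)) :=
    (stabilization.instIsClosed π).isClosedEmbedding_subtypeVal.isClosedMap _ hcl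
  have hmem : ∀ T ∈ tensorSpan π, tensorUnit 0 0 (1 : H →L[ℂ] H) * T *
      tensorUnit 0 0 (1 : H →L[ℂ] H) ∈ Subtype.val '' Set.range (cornerInclusion π) := by
    intro T hT
    suffices ∃ a, tensorUnit 0 0 (1 : H →L[ℂ] H) * T * tensorUnit 0 0 (1 : H →L[ℂ] H)
        = tensorUnit 0 0 (π a) by
      obtain ⟨a, ha⟩ := this
      exact ⟨_, ⟨a, rfl⟩, ha.symm⟩
    induction hT using Submodule.span_induction with
    | mem x hx =>
      obtain ⟨i, j, a, rfl⟩ := hx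
      by_cases hi : 0 = i
      · by_cases hj : j = 0
        · subst hi hj
          exact ⟨a, by rw [tensorUnit_mul_same, tensorUnit_mul_same, one_mul, mul_one]⟩
        · exact ⟨0, by rw [mul_assoc, tensorUnit_mul_of_ne _ _ hj, mul_zero, map_zero]
                       ext f : 1
                       simp [tensorUnit_apply]⟩
      · exact ⟨0, by rw [tensorUnit_mul_of_ne _ _ hi, zero_mul, map_zero]
                     ext f : 1
                     simp [tensorUnit_apply]⟩
    | zero => exact ⟨0, by ext f : 1; simp [tensorUnit_apply]⟩
    | add x y _ _ hx hy =>
      obtain ⟨a, ha⟩ := hx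
      obtain ⟨b, hb⟩ := hy
      exact ⟨a + b, by rw [mul_add, add_mul, ha, hb, map_add, tensorUnit_add]⟩
    | smul c x _ hx =>
      obtain ⟨a, ha⟩ := hx
      exact ⟨c • a, by rw [mul_smul_comm, smul_mul_assoc, ha, map_smul, tensorUnit_smul]⟩
  have hc : Continuous fun T : stabilization π =>
      tensorUnit 0 0 (1 : H →L[ℂ] H) * T.1 * tensorUnit 0 0 (1 : H →L[ℂ] H) :=
    (continuous_const.mul continuous_subtype_val).mul continuous_const
  obtain ⟨_, ⟨a, rfl⟩, ha⟩ := closure_minimal (fun T hT => hmem T.1 hT) (hcl'.preimage hc)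
    (dense_preimage_tensorSpan π T)
  exact ⟨a, ha.symm⟩

/-- With b = d* d and a = c* c, the order gives ‖d - d p‖ ≤ ‖c - c p‖, and the latter vanishes
because a p = a. In the application p = 1 ⊗ e₀₀ need not belong to the stabilization, so the lemma
is used in the ambient algebra of operators. -/
theorem isPos_eq_mul_of_isPos_sub {C : Type*} [NonUnitalCStarAlgebra C] {a b p : C}
    (hp : star p = p) (ha : a * p = a) (hb : IsPos b) (hab : IsPos (a - b)) : p * b * p = b := by
  have has : star a = a := by
    have := hab.star_eq
    rw [star_sub, hb.star_eq] at this
    exact sub_left_injective this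
  obtain ⟨d, rfl⟩ := hb
  let _ := CStarAlgebra.spectralOrder C
  have := CStarAlgebra.spectralOrderedRing C
  rw [isPos_iff_nonneg, sub_nonneg] at hab
  obtain ⟨c, hc⟩ := CStarAlgebra.nonneg_iff_eq_star_mul_self.1 (hab.trans' (star_mul_self_nonneg d))
  have h1 := CStarAlgebra.norm_sub_mul_le_of_star_mul_le (x := d) (y := c) (by rwa [← hc]) p
  have h2 : c - c * p = 0 := by
    rw [← CStarRing.star_mul_self_eq_zero_iff]
    have : star (c - c * p) * (c - c * p)
        = star c * c - star c * c * p - (star p * (star c * c) - star p * (star c * c * p)) := by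
      simp only [star_sub, star_mul]; noncomm_ring
    rw [this, ← hc, ha]; simp
  rw [h2, norm_zero] at h1
  have h3 : d * p = d := (sub_eq_zero.1 (norm_le_zero_iff.1 h1)).symm
  have h4 : p * star d = star d := by simpa [hp] using congrArg star h3
  rw [mul_assoc, mul_assoc, h3, ← mul_assoc, h4]

theorem isFullHereditary_range_cornerInclusion (hπ : Function.Injective π) :
    IsFullHereditary (NonUnitalStarAlgHom.range (cornerInclusion π)) := by
  constructor
  · rintro _ ⟨a, rfl⟩ b hb hab
    have h1 := isPos_eq_mul_of_isPos_sub (p := tensorUnit 0 0 (1 : H →L[ℂ] H))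
      (by rw [star_tensorUnit, star_one])
      (a := ((cornerInclusion π a : stabilization π) :
        lp (fun _ : ℕ => H) 2 →L[ℂ] lp (fun _ : ℕ => H) 2)) (b := b.1)
      (by
        change tensorUnit 0 0 (π a) * _ = tensorUnit 0 0 (π a)
        rw [tensorUnit_mul_same, mul_one])
      (hb.map (NonUnitalStarSubalgebraClass.subtype (stabilization π)))
      (hab.map (NonUnitalStarSubalgebraClass.subtype (stabilization π)))
    obtain ⟨c, hc⟩ := tensorUnit_mul_mul_mem_range π hπ b
    exact ⟨c, Subtype.ext (hc.symm.trans h1)⟩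
  · set I := TwoSidedIdeal.span
      ((NonUnitalStarAlgHom.range (cornerInclusion π) : Set (stabilization π))) with hI
    let unit : ℕ → ℕ → A → stabilization π := fun i j a =>
      ⟨tensorUnit i j (π a), NonUnitalStarSubalgebra.le_topologicalClosure _
        (NonUnitalStarAlgebra.subset_adjoin ℂ _ ⟨i, j, a, rfl⟩)⟩
    have hunit : ∀ i j, Continuous (unit i j) := fun i j =>
      ((continuous_tensorUnit i j).comp (continuous_starHom π)).subtype_mk _
    have hcl : ∀ i j a, unit i j a ∈ closure (I : Set (stabilization π)) := by
      intro i j a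
      -- (b ⊗ e_i0)(c ⊗ e_00)(d ⊗ e_0j) = bcd ⊗ e_ij carries the corner to every matrix position;
      -- approximate units then remove the outer factors.
      have h3 : ∀ b c d, unit i j (b * c * d) ∈ I := by
        intro b c d
        have : unit i j (b * c * d) = unit i 0 b * cornerInclusion π c * unit 0 j d := by
          apply Subtype.ext
          change tensorUnit i j (π (b * c * d)) =
            tensorUnit i 0 (π b) * tensorUnit 0 0 (π c) * tensorUnit 0 j (π d)
          rw [tensorUnit_mul_same, tensorUnit_mul_same, map_mul, map_mul]
        rw [this]
        exact I.mul_mem_right _ _ (I.mul_mem_left _ _ (TwoSidedIdeal.subset_span ⟨c, rfl⟩))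
      let _ := CStarAlgebra.spectralOrder A
      have := CStarAlgebra.spectralOrderedRing A
      have hau := CStarAlgebra.increasingApproximateUnit A
      have h2 : ∀ b, unit i j (b * a) ∈ closure (I : Set (stabilization π)) := fun b =>
        mem_closure_of_tendsto (((hunit i j).tendsto _).comp (hau.tendsto_mul_left (b * a)))
          (.of_forall fun d => h3 b a d)
      exact isClosed_closure.mem_of_tendsto
        (((hunit i j).tendsto _).comp (hau.tendsto_mul_right a)) (.of_forall fun b => h2 b)
    let K : AddSubgroup (stabilization π) := (AddSubgroup.ofClass I).topologicalClosure
    have hK : (K : Set (stabilization π)) = closure (I : Set (stabilization π)) := rfl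
    have hspan : ∀ T ∈ tensorSpan π, ∀ hT : T ∈ stabilization π,
        (⟨T, hT⟩ : stabilization π) ∈ K := by
      have key : ∀ T ∈ tensorSpan π, ∃ S ∈ K, S.1 = T := by
        intro T hT
        rw [tensorSpan, Submodule.mem_span_set'] at hT
        obtain ⟨n, c, g, rfl⟩ := hT
        choose i j a ha using fun k => (g k).2
        -- K is only an additive subgroup, so the scalars are absorbed into A.
        refine ⟨∑ k, unit (i k) (j k) (c k • a k), sum_mem fun k _ => hcl _ _ _, ?_⟩
        rw [AddSubmonoidClass.coe_finsetSum]
        refine Finset.sum_congr rfl fun k _ => ?_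
        rw [ha k]
        change tensorUnit (i k) (j k) (π (c k • a k)) = _
        rw [map_smul, tensorUnit_smul]
      intro T hT hT'
      obtain ⟨S, hS, rfl⟩ := key T hT
      exact hS
    intro T
    have := closure_minimal (t := (K : Set (stabilization π))) (fun S hS => hspan S.1 hS S.2)
      (by rw [hK]; exact isClosed_closure) (dense_preimage_tensorSpan π T)
    exact this

end Stabilization

theorem corollary5p4 :
    (∀ (B : Type u) [NonUnitalCStarAlgebra B] (A : NonUnitalStarSubalgebra ℂ B)
      [IsClosed (A : Set B)], IsFullHereditary A →
        IsOrderedTVSIso (TraceSpace.posCone B) (TraceSpace.posCone A) (TraceSpace.restrict A) ∧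
        IsOrderedTVSIso (TraceDual.posCone A) (TraceDual.posCone B)
          (TraceDual.induced (TraceSpace.restrict A))) ∧
    (∀ (A : Type u) [NonUnitalCStarAlgebra A] (H : Type v) [NormedAddCommGroup H]
      [InnerProductSpace ℂ H] [CompleteSpace H] (π : A →⋆ₙₐ[ℂ] (H →L[ℂ] H))
      (hπ : Function.Injective π),
        IsTraceIso (TraceSpace.comap (cornerInclusion π) (cornerInclusion_injective π hπ))) ∧
    (∀ (A : Type u) (B : Type v) [NonUnitalCStarAlgebra A] [NonUnitalCStarAlgebra B],
      MoritaEquivalent.{u, v, w} A B →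
        ∃ γ : TraceSpace B →L[ℝ] TraceSpace A, IsTraceIso γ) := by
  refine ⟨fun B _ A _ hA => ?_, fun A _ H _ _ _ π hπ => ?_, fun A B _ _ hAB => ?_⟩
  · have hr : NonUnitalStarAlgHom.range (NonUnitalStarSubalgebraClass.subtype A) = A := by
      ext x
      exact ⟨fun ⟨y, hy⟩ => hy ▸ y.2, fun hx => ⟨⟨x, hx⟩, rfl⟩⟩
    rw [← hr] at hA
    exact IsFullHereditary.isTraceIso_comap hA Subtype.val_injective
  · exact (isFullHereditary_range_cornerInclusion π hπ).isTraceIso_comap _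
  · obtain ⟨C, _, φ, ψ, hφ, hψ, hA, hB⟩ := hAB
    obtain ⟨e, -, he⟩ := (hB.isTraceIso_comap hψ).1
    exact ⟨_, ((hA.isTraceIso_comap hφ).1.comp (IsOrderedTVSIso.symm e he)).isTraceIso⟩
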